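/- An open polygonal chain $P=(v_0,\dots,v_n)$ with $n\ge 1$ edges in $\mathbb R^4$ is \emph{simple} if $v_i\ne v_{i+1}$ for all $i$, the segments $v_{i-1}v_i$ and $v_iv_{i+1}$ meet only at $v_i$, and non-adjacent edges are disjoint; it is \emph{straight} if the angle at each interior vertex $v_1,\dots,v_{n-1}$ is $\pi$. A \emph{move} at a joint $v_k$ rotates the part $(v_0,\dots,v_{k-1})$ rigidly and monotonically, by a total angle in $[0,\pi]$, in a plane through $v_k$ (that is, about a 2-flat axis through $v_k$ orthogonal to that plane), while $v_k,\dots,v_n$ stay fixed. Theorem. Every simple open polygonal chain in $\mathbb R^4$ can be straightened by a continuous motion that preserves all edge lengths and keeps the chain simple throughout, and such a motion can be computed. More precisely, there are a single real-RAM program (exact real arithmetic with $+,-,\times,/,\sqrt{\phantom{x}}$ and comparisons at unit cost, reals stored in arrays and registers) and a constant $C$ such that for every $n\ge 1$ and every simple open chain $P=(v_0,\dots,v_n)$ in $\mathbb R^4$ the program, given $n$ and the coordinates of the vertices, halts after at most $Cn^2$ steps, uses at most $Cn$ memory cells (the output tape is write-only and not counted), and writes a list of at most $Cn$ moves (each as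 its joint, an orthonormal basis of its plane, and the cosine of its angle) such that performing these moves one after the other, starting at $P$, is a continuous motion that preserves the edge lengths and simplicity at all times and ends in a straight chain. -/

import Mathlib

/-! ## Polygonal chains in four-dimensional space -/

/-- Four-dimensional Euclidean space. -/
abbrev E4 : Type := EuclideanSpace ℝ (Fin 4)

/-- An open polygonal chain `(v₀, …, vₙ)` with `n` edges, given by its vertices. -/
abbrev Chain (n : ℕ) : Type := Fin (n + 1) → E4

namespace Chain

/-- The `i`-th edge: the closed segment from `vᵢ` to `vᵢ₊₁`. -/
def edge {n : ℕ} (P : Chain n) (i : Fin n) : Set E4 :=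
  segment ℝ (P i.castSucc) (P i.succ)

/-- A chain is simple if its edges are nondegenerate segments and only adjacent edges intersect,
and only at the endpoint they share. -/
structure IsSimple {n : ℕ} (P : Chain n) : Prop where
  nondegenerate : ∀ i : Fin n, P i.castSucc ≠ P i.succ
  adjacent : ∀ i j : Fin n, (i : ℕ) + 1 = j → P.edge i ∩ P.edge j = {P j.castSucc}
  nonadjacent : ∀ i j : Fin n, (i : ℕ) + 1 < j → Disjoint (P.edge i) (P.edge j)

/-- A chain is straight if every interior joint has angle `π`. -/
def IsStraight {n : ℕ} (P : Chain n) : Prop :=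
  ∀ i j : Fin n, (i : ℕ) + 1 = j →
    EuclideanGeometry.angle (P i.castSucc) (P j.castSucc) (P j.succ) = Real.pi

/-- `γ`, on the time interval `[0, T]`, is a continuous motion of the chain `P` that preserves all
edge lengths and simplicity and that ends in a straight chain. -/
structure IsStraightening {n : ℕ} (P : Chain n) (T : ℝ) (γ : ℝ → Chain n) : Prop where
  continuousOn : ContinuousOn γ (Set.Icc 0 T)
  start : γ 0 = P
  length : ∀ t ∈ Set.Icc 0 T, ∀ i : Fin n,
    dist (γ t i.castSucc) (γ t i.succ) = dist (P i.castSucc) (P i.succ)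
  simple : ∀ t ∈ Set.Icc 0 T, (γ t).IsSimple
  straight : (γ T).IsStraight

end Chain

/-! ## Moves -/

/-- Rotation of four-space by the angle `φ` in the plane through `p` spanned by the orthonormal
vectors `a`, `b` (from `a` towards `b`); it fixes pointwise the axis, which is the 2-flat through
`p` orthogonal to `a` and `b`. -/
noncomputable def rotate (p a b : E4) (φ : ℝ) (x : E4) : E4 :=
  x + ((Real.cos φ - 1) * inner ℝ a (x - p) - Real.sin φ * inner ℝ b (x - p)) • a
    + (Real.sin φ * inner ℝ a (x - p) + (Real.cos φ - 1) * inner ℝ b (x - p)) • b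

/-- A move of a chain with `n` edges: a joint, an orthonormal pair spanning the plane of rotation,
and the cosine of the total angle, which lies in `[0, π]`. -/
structure Move (n : ℕ) where
  joint : Fin (n + 1)
  a : E4
  b : E4
  c : ℝ
  norm_a : ‖a‖ = 1
  norm_b : ‖b‖ = 1
  orthogonal : inner ℝ a b = 0
  neg_one_le : -1 ≤ c
  le_one : c ≤ 1

namespace Move

/-- The total angle of rotation. -/
noncomputable def angle {n : ℕ} (m : Move n) : ℝ := Real.arccos m.c

/-- The position of the chain after the fraction `s ∈ [0, 1]` of a move starting at `P`: the part
of the chain before the joint rotates rigidly and monotonically about an axis through the joint,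
and the other vertices stay fixed. -/
noncomputable def apply {n : ℕ} (m : Move n) (s : ℝ) (P : Chain n) : Chain n := fun i =>
  if i < m.joint then rotate (P m.joint) m.a m.b (s * m.angle) (P i) else P i

/-- A move written as ten words: one index and nine real numbers. -/
def encode {n : ℕ} (m : Move n) : List (ℕ ⊕ ℝ) :=
  [.inl m.joint, .inr (m.a 0), .inr (m.a 1), .inr (m.a 2), .inr (m.a 3),
    .inr (m.b 0), .inr (m.b 1), .inr (m.b 2), .inr (m.b 3), .inr m.c]

end Move

/-- The motion `γ` performs the moves of the list `ms` one after the other, the `j`-th one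
(counted from zero) during the time interval `[j, j + 1]`. -/
def Performs {n : ℕ} (ms : List (Move n)) (γ : ℝ → Chain n) : Prop :=
  ∀ (j : ℕ) (hj : j < ms.length), ∀ s ∈ Set.Icc (0 : ℝ) 1,
    γ (j + s) = (ms[j]'hj).apply s (γ j)

/-! ## The real RAM

Programs of a small imperative language over index variables (natural numbers, which can only be
set to constants, copied, incremented, decremented and compared), real variables, and arrays of
reals. Reals are exact; the operations are `+`, `-`, `*`, `/`, square root and comparison, at unit
cost each. A program is a finite text that does not depend on the input. -/

namespace RealRAM

/-- A memory state: index variables, real variables, arrays, and the output written so far. -/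
structure State where
  idx : ℕ → ℕ
  reg : ℕ → ℝ
  arr : ℕ → ℕ → ℝ
  out : List (ℕ ⊕ ℝ)

/-- Index expressions. -/
inductive NExp : Type
  | const (k : ℕ)
  | var (i : ℕ)
  | succ (e : NExp)
  | pred (e : NExp)

namespace NExp

def eval (s : State) : NExp → ℕ
  | const k => k
  | var i => s.idx i
  | succ e => e.eval s + 1
  | pred e => e.eval s - 1

def cost : NExp → ℕ
  | const _ => 1
  | var _ => 1
  | succ e => e.cost + 1
  | pred e => e.cost + 1

/-- All variables occurring in the expression have a number below `e.width`. -/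
def width : NExp → ℕ
  | const _ => 0
  | var i => i + 1
  | succ e => e.width
  | pred e => e.width

end NExp

/-- Real expressions; `get a e` reads the cell with index `e` of the array `a`. -/
inductive RExp : Type
  | const (z : ℤ)
  | var (i : ℕ)
  | get (a : ℕ) (e : NExp)
  | add (e f : RExp)
  | sub (e f : RExp)
  | mul (e f : RExp)
  | div (e f : RExp)
  | sqrt (e : RExp)

namespace RExp

noncomputable def eval (s : State) : RExp → ℝ
  | const z => z
  | var i => s.reg i
  | get a e => s.arr a (e.eval s)
  | add e f => e.eval s + f.eval s
  | sub e f => e.eval s - f.eval s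
  | mul e f => e.eval s * f.eval s
  | div e f => e.eval s / f.eval s
  | sqrt e => Real.sqrt (e.eval s)

/-- The evaluation meets no array index outside `0, …, N - 1`, no division by zero and no square
root of a negative number. -/
def Defined (N : ℕ) (s : State) : RExp → Prop
  | const _ => True
  | var _ => True
  | get _ e => e.eval s < N
  | add e f => e.Defined N s ∧ f.Defined N s
  | sub e f => e.Defined N s ∧ f.Defined N s
  | mul e f => e.Defined N s ∧ f.Defined N s
  | div e f => e.Defined N s ∧ f.Defined N s ∧ f.eval s ≠ 0
  | sqrt e => e.Defined N s ∧ 0 ≤ e.eval s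

def cost : RExp → ℕ
  | const _ => 1
  | var _ => 1
  | get _ e => e.cost + 1
  | add e f => e.cost + f.cost + 1
  | sub e f => e.cost + f.cost + 1
  | mul e f => e.cost + f.cost + 1
  | div e f => e.cost + f.cost + 1
  | sqrt e => e.cost + 1

def width : RExp → ℕ
  | const _ => 0
  | var i => i + 1
  | get a e => max (a + 1) e.width
  | add e f => max e.width f.width
  | sub e f => max e.width f.width
  | mul e f => max e.width f.width
  | div e f => max e.width f.width
  | sqrt e => e.width

end RExp

/-- Tests. -/
inductive BExp : Type
  | nlt (e f : NExp)
  | rlt (e f : RExp)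
  | not (b : BExp)
  | and (b c : BExp)
  | or (b c : BExp)

namespace BExp

def Holds (s : State) : BExp → Prop
  | nlt e f => e.eval s < f.eval s
  | rlt e f => e.eval s < f.eval s
  | not b => ¬ b.Holds s
  | and b c => b.Holds s ∧ c.Holds s
  | or b c => b.Holds s ∨ c.Holds s

def Defined (N : ℕ) (s : State) : BExp → Prop
  | nlt _ _ => True
  | rlt e f => e.Defined N s ∧ f.Defined N s
  | not b => b.Defined N s
  | and b c => b.Defined N s ∧ c.Defined N s
  | or b c => b.Defined N s ∧ c.Defined N s

def cost : BExp → ℕ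
  | nlt e f => e.cost + f.cost + 1
  | rlt e f => e.cost + f.cost + 1
  | not b => b.cost + 1
  | and b c => b.cost + c.cost + 1
  | or b c => b.cost + c.cost + 1

def width : BExp → ℕ
  | nlt e f => max e.width f.width
  | rlt e f => max e.width f.width
  | not b => b.width
  | and b c => max b.width c.width
  | or b c => max b.width c.width

end BExp

/-- Programs. -/
inductive Prog : Type
  | skip
  | setIdx (i : ℕ) (e : NExp)
  | setReg (i : ℕ) (e : RExp)
  | setArr (a : ℕ) (e : NExp) (f : RExp)
  | writeIdx (e : NExp)
  | writeReal (e : RExp)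
  | seq (p q : Prog)
  | ite (b : BExp) (p q : Prog)
  | while (b : BExp) (p : Prog)

/-- All variables and arrays occurring in the program have a number below `p.width`. -/
def Prog.width : Prog → ℕ
  | .skip => 0
  | .setIdx i e => max (i + 1) e.width
  | .setReg i e => max (i + 1) e.width
  | .setArr a e f => max (a + 1) (max e.width f.width)
  | .writeIdx e => e.width
  | .writeReal e => e.width
  | .seq p q => max p.width q.width
  | .ite b p q => max b.width (max p.width q.width)
  | .while b p => max b.width p.width

/-- The number of memory cells of the program if its arrays have length `N`: `p.width` index
variables, `p.width` real variables and `p.width` arrays. -/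
def Prog.space (p : Prog) (N : ℕ) : ℕ := p.width * (N + 2)

/-- `Exec N p s t s'`: with arrays of length `N`, the program `p` started in the state `s` halts
after `t` steps in the state `s'`, without an access outside the arrays and without an undefined
operation. -/
inductive Exec (N : ℕ) : Prog → State → ℕ → State → Prop
  | skip (s : State) : Exec N .skip s 1 s
  | setIdx (i : ℕ) (e : NExp) (s : State) :
      Exec N (.setIdx i e) s (e.cost + 1) { s with idx := Function.update s.idx i (e.eval s) }
  | setReg (i : ℕ) (e : RExp) (s : State) (h : e.Defined N s) :
      Exec N (.setReg i e) s (e.cost + 1) { s with reg := Function.update s.reg i (e.eval s) }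
  | setArr (a : ℕ) (e : NExp) (f : RExp) (s : State) (he : e.eval s < N) (hf : f.Defined N s) :
      Exec N (.setArr a e f) s (e.cost + f.cost + 1)
        { s with arr := Function.update s.arr a
                          (Function.update (s.arr a) (e.eval s) (f.eval s)) }
  | writeIdx (e : NExp) (s : State) :
      Exec N (.writeIdx e) s (e.cost + 1) { s with out := s.out ++ [.inl (e.eval s)] }
  | writeReal (e : RExp) (s : State) (h : e.Defined N s) :
      Exec N (.writeReal e) s (e.cost + 1) { s with out := s.out ++ [.inr (e.eval s)] }
  | seq {p q : Prog} {s s' s'' : State} {t t' : ℕ} (hp : Exec N p s t s')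
      (hq : Exec N q s' t' s'') : Exec N (.seq p q) s (t + t') s''
  | ite_true {b : BExp} {p q : Prog} {s s' : State} {t : ℕ} (hd : b.Defined N s) (hb : b.Holds s)
      (hp : Exec N p s t s') : Exec N (.ite b p q) s (b.cost + t + 1) s'
  | ite_false {b : BExp} {p q : Prog} {s s' : State} {t : ℕ} (hd : b.Defined N s)
      (hb : ¬ b.Holds s) (hq : Exec N q s t s') : Exec N (.ite b p q) s (b.cost + t + 1) s'
  | while_true {b : BExp} {p : Prog} {s s' s'' : State} {t t' : ℕ} (hd : b.Defined N s)
      (hb : b.Holds s) (hp : Exec N p s t s') (hw : Exec N (.while b p) s' t' s'') :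
      Exec N (.while b p) s (b.cost + t + t' + 1) s''
  | while_false {b : BExp} {p : Prog} {s : State} (hd : b.Defined N s) (hb : ¬ b.Holds s) :
      Exec N (.while b p) s (b.cost + 1) s

/-- The initial state for the input chain `P`: index variable `0` holds the number of edges, array
`k` for `k = 0, 1, 2, 3` holds the `k`-th coordinates of the vertices, the rest of the memory is
zero, and the output is empty. -/
noncomputable def input {n : ℕ} (P : Chain n) : State where
  idx := fun i => if i = 0 then n else 0
  reg := fun _ => 0
  arr := fun k i => if h : k < 4 ∧ i < n + 1 then P ⟨i, h.2⟩ ⟨k, h.1⟩ else 0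
  out := []

end RealRAM

/-! ## Rotations -/

/-! The chain is straightened from its free end. The vertices up to `v_k` form a rod: they lie in
order on a ray of direction `a` that ends at `v_k`, while `v_k, …, v_n` are still where they
started. Let `u` be the unit vector from `v_{k+1}` to `v_k`. Turning the rod straight onto the line
of the next edge might hit the rest of the chain, so it makes a detour through a unit vector `w` in
general position (`exists_moves_of_rod`).

Move 1 turns the rod at `v_k` from `a` to `w`. A collision with a point `q` would put `w` in the
span of `a` and `q - v_k`. Now rod and edge lie in the plane of `u` and `w` through `v_{k+1}`, which
the later edges meet at most on the line of direction `u`. With `θ` the angle from `u` to `w`, move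
2 turns both at `v_{k+1}` by `π/2 - θ/2`; everything except `v_{k+1}` rises strictly to one side of
that line. Move 3 turns the rod at `v_k` back by `θ`, on the same side of the line, until it
prolongs the edge. So three moves lengthen the rod by one edge.

All conditions on `w` exclude spans of three vectors: `a` or `u`, and the two ends of an edge seen
from `v_k`. These are proper subspaces because the dimension is four. The curve `(1, t, t², t³)`
meets a hyperplane through the origin at the roots of a nonzero polynomial, so a large `t` avoids
finitely many of them. An explicit root bound (`dot_twistedCurve_ne_zero`) and explicit normals that
also cover linearly dependent triples (`not_mem_span_of_normals`) make `t` computable in one scan of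
the remaining edges.

The scan costs a linear number of steps per joint. The program never needs the current positions of
the rod's vertices: the direction `a` and the unmoved input vertices suffice, so nothing beyond the
input and a few registers is stored. Cosines and half-angle formulas replace angles. -/

/-- The linear part of `rotate`. -/
noncomputable def rotateLinear (a b : E4) (φ : ℝ) : E4 →ₗ[ℝ] E4 where
  toFun v := v + ((Real.cos φ - 1) * inner ℝ a v - Real.sin φ * inner ℝ b v) • a
    + (Real.sin φ * inner ℝ a v + (Real.cos φ - 1) * inner ℝ b v) • b
  map_add' x y := by simp only [inner_add_right]; module
  map_smul' r x := by simp only [inner_smul_right, RingHom.id_apply]; module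

theorem rotateLinear_apply (a b : E4) (φ : ℝ) (v : E4) : rotateLinear a b φ v =
    v + ((Real.cos φ - 1) * inner ℝ a v - Real.sin φ * inner ℝ b v) • a
      + (Real.sin φ * inner ℝ a v + (Real.cos φ - 1) * inner ℝ b v) • b := rfl

theorem rotate_eq (p a b : E4) (φ : ℝ) (x : E4) :
    rotate p a b φ x = p + rotateLinear a b φ (x - p) := by
  rw [rotate, rotateLinear_apply]; module

theorem rotate_sub_rotate (p a b : E4) (φ : ℝ) (x y : E4) :
    rotate p a b φ x - rotate p a b φ y = rotateLinear a b φ (x - y) := by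
  simp only [rotate_eq, map_sub]; module

@[simp] theorem rotate_self (p a b : E4) (φ : ℝ) : rotate p a b φ p = p := by
  simp [rotate_eq]

@[simp] theorem rotate_zero (p a b : E4) (x : E4) : rotate p a b 0 x = x := by
  simp [rotate]

section Orthonormal

variable {a b : E4} (ha : ‖a‖ = 1) (hb : ‖b‖ = 1) (hab : inner ℝ a b = 0)
include ha hb hab

theorem norm_rotateLinear (φ : ℝ) (v : E4) : ‖rotateLinear a b φ v‖ = ‖v‖ := by
  have hba : inner ℝ b a = 0 := by rw [real_inner_comm]; exact hab
  have haa : inner ℝ a a = 1 := by rw [real_inner_self_eq_norm_sq, ha]; norm_num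
  have hbb : inner ℝ b b = 1 := by rw [real_inner_self_eq_norm_sq, hb]; norm_num
  have key : ‖rotateLinear a b φ v‖ ^ 2 = ‖v‖ ^ 2 := by
    rw [← real_inner_self_eq_norm_sq, ← real_inner_self_eq_norm_sq, rotateLinear_apply]
    simp only [inner_add_left, inner_add_right, real_inner_smul_left, real_inner_smul_right,
      haa, hbb, hab, hba, real_inner_comm a v, real_inner_comm b v]
    have := Real.sin_sq_add_cos_sq φ
    generalize inner ℝ a v = x
    generalize inner ℝ b v = y
    linear_combination (x ^ 2 + y ^ 2) * this
  exact (sq_eq_sq₀ (norm_nonneg _) (norm_nonneg _)).1 key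

theorem dist_rotate (p : E4) (φ : ℝ) (x y : E4) :
    dist (rotate p a b φ x) (rotate p a b φ y) = dist x y := by
  rw [dist_eq_norm, rotate_sub_rotate, norm_rotateLinear ha hb hab, dist_eq_norm]

theorem rotate_injective (p : E4) (φ : ℝ) : Function.Injective (rotate p a b φ) := fun x y h => by
  rw [← dist_eq_zero, ← dist_rotate ha hb hab p φ, h, dist_self]

theorem rotateLinear_plane (φ ξ η : ℝ) : rotateLinear a b φ (ξ • a + η • b) =
    (ξ * Real.cos φ - η * Real.sin φ) • a + (ξ * Real.sin φ + η * Real.cos φ) • b := by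
  have hba : inner ℝ b a = 0 := by rw [real_inner_comm]; exact hab
  have haa : inner ℝ a a = 1 := by rw [real_inner_self_eq_norm_sq, ha]; norm_num
  have hbb : inner ℝ b b = 1 := by rw [real_inner_self_eq_norm_sq, hb]; norm_num
  simp only [rotateLinear_apply, inner_add_right, real_inner_smul_right, haa, hbb, hab, hba]
  module

end Orthonormal

theorem rotate_image_segment (p a b : E4) (φ : ℝ) (x y : E4) :
    rotate p a b φ '' segment ℝ x y = segment ℝ (rotate p a b φ x) (rotate p a b φ y) := by
  have h : rotate p a b φ =
      ((rotateLinear a b φ).toAffineMap + AffineMap.const ℝ E4 (p - rotateLinear a b φ p)) := by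
    funext z
    simp [rotate_eq]
    abel
  rw [h, ← AffineMap.coe_add, image_segment]

theorem continuous_rotate_angle (p a b x : E4) : Continuous fun φ => rotate p a b φ x := by
  unfold rotate
  fun_prop

/-! ## Simple chains and moves -/

namespace Chain

variable {n : ℕ}

/-- Adjacent and non-adjacent pairs are merged into one condition on a common point, the form in
which simplicity is carried along a move. -/
theorem isSimple_iff (P : Chain n) : P.IsSimple ↔ (∀ i : Fin n, P i.castSucc ≠ P i.succ) ∧
    ∀ i j : Fin n, i < j → ∀ x ∈ P.edge i, x ∈ P.edge j →
      (i : ℕ) + 1 = j ∧ x = P j.castSucc := by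
  constructor
  · intro h
    refine ⟨h.nondegenerate, fun i j hij x hi hj => ?_⟩
    by_cases hadj : (i : ℕ) + 1 = j
    · have : x ∈ P.edge i ∩ P.edge j := ⟨hi, hj⟩
      rw [h.adjacent i j hadj] at this
      exact ⟨hadj, this⟩
    · have hlt : (i : ℕ) + 1 < j := by
        have : (i : ℕ) < j := hij
        omega
      exact absurd hj (Set.disjoint_left.1 (h.nonadjacent i j hlt) hi)
  · rintro ⟨h1, h2⟩
    refine ⟨h1, fun i j hij => ?_, fun i j hij => ?_⟩
    · ext x
      constructor
      · rintro ⟨hi, hj⟩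
        exact (h2 i j (Fin.lt_def.2 (by omega)) x hi hj).2
      · rintro rfl
        have : j.castSucc = i.succ := Fin.ext (by simp [hij])
        refine ⟨?_, left_mem_segment ℝ _ _⟩
        rw [this]
        exact right_mem_segment ℝ _ _
    · refine Set.disjoint_left.2 fun x hi hj => ?_
      have := (h2 i j (Fin.lt_def.2 (by omega)) x hi hj).1
      omega

end Chain

namespace Move

variable {n : ℕ} (m : Move n) (s : ℝ) (P : Chain n)

/-- The joint is the centre of rotation, so the formula extends to it. Hence the edge that ends at
the joint is rotated as a whole. -/
theorem apply_of_le {i : Fin (n + 1)} (h : i ≤ m.joint) :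
    m.apply s P i = rotate (P m.joint) m.a m.b (s * m.angle) (P i) := by
  rcases h.lt_or_eq with h | rfl
  · simp [apply, h]
  · simp [apply]

theorem apply_of_ge {i : Fin (n + 1)} (h : m.joint ≤ i) : m.apply s P i = P i := by
  simp [apply, not_lt.2 h]

@[simp] theorem apply_zero : m.apply 0 P = P := by
  funext i
  simp [apply]

theorem continuous_apply : Continuous fun s => m.apply s P := by
  refine continuous_pi fun i => ?_
  unfold apply
  split_ifs
  · exact (continuous_rotate_angle _ _ _ _).comp (by fun_prop)
  · fun_prop

theorem edge_apply_of_lt {i : Fin n} (h : i.castSucc < m.joint) : (m.apply s P).edge i =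
    rotate (P m.joint) m.a m.b (s * m.angle) '' P.edge i := by
  rw [Chain.edge, apply_of_le _ _ _ h.le, apply_of_le _ _ _ (Fin.castSucc_lt_iff_succ_le.1 h),
    ← rotate_image_segment, Chain.edge]

theorem edge_apply_of_ge {i : Fin n} (h : m.joint ≤ i.castSucc) :
    (m.apply s P).edge i = P.edge i := by
  rw [Chain.edge, apply_of_ge _ _ _ h, apply_of_ge _ _ _ (h.trans i.castSucc_lt_succ.le),
    Chain.edge]

theorem dist_apply (i : Fin n) : dist (m.apply s P i.castSucc) (m.apply s P i.succ) =
    dist (P i.castSucc) (P i.succ) := by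
  by_cases h : i.castSucc < m.joint
  · rw [apply_of_le _ _ _ h.le, apply_of_le _ _ _ (Fin.castSucc_lt_iff_succ_le.1 h),
      dist_rotate m.norm_a m.norm_b m.orthogonal]
  · rw [not_lt] at h
    rw [apply_of_ge _ _ _ h, apply_of_ge _ _ _ (h.trans i.castSucc_lt_succ.le)]

/-- A partially performed move keeps the chain simple if it brings no point before the joint onto
a different point after the joint. -/
theorem isSimple_apply (hP : P.IsSimple)
    (h : ∀ i j : Fin n, i.castSucc < m.joint → m.joint ≤ j.castSucc → ∀ p ∈ P.edge i,
      ∀ q ∈ P.edge j, rotate (P m.joint) m.a m.b (s * m.angle) p = q → p = q) :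
    (m.apply s P).IsSimple := by
  rw [Chain.isSimple_iff] at hP ⊢
  refine ⟨fun i => ?_, fun i j hij x hi hj => ?_⟩
  · rw [← dist_pos, dist_apply, dist_pos]
    exact hP.1 i
  · have hij' : i.castSucc < j.castSucc := hij
    -- Two edges on the same side of the joint move by one isometry. Only a pair on different sides
    -- needs the hypothesis, which pulls the common point back to a common point of the original
    -- edges.
    by_cases hjm : j.castSucc < m.joint
    · rw [edge_apply_of_lt _ _ _ hjm] at hj
      rw [edge_apply_of_lt _ _ _ (hij'.trans hjm)] at hi
      obtain ⟨p, hp, rfl⟩ := hi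
      obtain ⟨q, hq, hqp⟩ := hj
      obtain rfl := rotate_injective m.norm_a m.norm_b m.orthogonal _ _ hqp
      obtain ⟨h1, h2⟩ := hP.2 i j hij q hp hq
      refine ⟨h1, ?_⟩
      rw [apply_of_le _ _ _ hjm.le, ← h2]
    · rw [not_lt] at hjm
      rw [edge_apply_of_ge _ _ _ hjm] at hj
      rw [apply_of_ge _ _ _ hjm]
      by_cases him : i.castSucc < m.joint
      · rw [edge_apply_of_lt _ _ _ him] at hi
        obtain ⟨p, hp, hpx⟩ := hi
        obtain rfl := h i j him hjm p hp x hj hpx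
        exact hP.2 i j hij p hp hj
      · rw [not_lt] at him
        rw [edge_apply_of_ge _ _ _ him] at hi
        exact hP.2 i j hij x hi hj

end Move

/-! ## The motion that performs a list of moves -/

/-- The motion that performs the moves of a list one after the other, starting at `P`. -/
noncomputable def motion {n : ℕ} : List (Move n) → Chain n → ℝ → Chain n
  | [], P, _ => P
  | m :: ms, P, t => if t ≤ 1 then m.apply t P else motion ms (m.apply 1 P) (t - 1)

/-- The position after all moves of a list. -/
noncomputable def perform {n : ℕ} (ms : List (Move n)) (P : Chain n) : Chain n :=
  ms.foldl (fun Q m => m.apply 1 Q) P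

/-- The chain is simple while the moves of the list are performed. -/
def StaysSimple {n : ℕ} : List (Move n) → Chain n → Prop
  | [], P => P.IsSimple
  | m :: ms, P => (∀ s ∈ Set.Icc (0 : ℝ) 1, (m.apply s P).IsSimple) ∧
      StaysSimple ms (m.apply 1 P)

section Motion

variable {n : ℕ}

theorem motion_cons_of_le (m : Move n) (ms : List (Move n)) (P : Chain n) {t : ℝ} (h : t ≤ 1) :
    motion (m :: ms) P t = m.apply t P := if_pos h

@[simp] theorem motion_zero (ms : List (Move n)) (P : Chain n) : motion ms P 0 = P := by
  cases ms with
  | nil => rfl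
  | cons m ms => rw [motion_cons_of_le _ _ _ zero_le_one, Move.apply_zero]

theorem motion_cons_of_ge (m : Move n) (ms : List (Move n)) (P : Chain n) {t : ℝ} (h : 1 ≤ t) :
    motion (m :: ms) P t = motion ms (m.apply 1 P) (t - 1) := by
  rcases h.eq_or_lt with rfl | h
  · rw [motion_cons_of_le _ _ _ le_rfl, sub_self, motion_zero]
  · exact if_neg (not_le.2 h)

/-- The two branches agree at time `1`, since the remaining motion starts where the first move ends.
-/
theorem continuous_motion (ms : List (Move n)) (P : Chain n) : Continuous (motion ms P) := by
  induction ms generalizing P with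
  | nil => exact continuous_const
  | cons m ms ih =>
    refine Continuous.if_le (m.continuous_apply P)
      ((ih (m.apply 1 P)).comp (continuous_id.sub continuous_const)) continuous_id
      continuous_const fun t ht => ?_
    simp [ht]

theorem performs_motion (ms : List (Move n)) (P : Chain n) : Performs ms (motion ms P) := by
  induction ms generalizing P with
  | nil => intro j hj; simp at hj
  | cons m ms ih =>
    intro j hj s hs
    cases j with
    | zero => simp [motion_cons_of_le m ms P hs.2]
    | succ j =>
      have hj0 : (0 : ℝ) ≤ j := j.cast_nonneg
      have := ih (m.apply 1 P) j (by simpa using hj) s hs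
      rw [motion_cons_of_ge _ _ _ (by push_cast; linarith [hs.1]),
        motion_cons_of_ge _ _ _ (by push_cast; linarith)]
      have e1 : ((j + 1 : ℕ) : ℝ) + s - 1 = j + s := by push_cast; ring
      have e2 : ((j + 1 : ℕ) : ℝ) - 1 = j := by push_cast; ring
      rw [e1, e2]
      simpa using this

theorem dist_motion (ms : List (Move n)) (P : Chain n) (t : ℝ) (i : Fin n) :
    dist (motion ms P t i.castSucc) (motion ms P t i.succ) =
      dist (P i.castSucc) (P i.succ) := by
  induction ms generalizing P t with
  | nil => rfl
  | cons m ms ih =>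
    rcases le_total t 1 with h | h
    · rw [motion_cons_of_le _ _ _ h, Move.dist_apply]
    · rw [motion_cons_of_ge _ _ _ h, ih, Move.dist_apply]

theorem StaysSimple.motion {ms : List (Move n)} {P : Chain n} (h : StaysSimple ms P) {t : ℝ}
    (h0 : 0 ≤ t) : (motion ms P t).IsSimple := by
  induction ms generalizing P t with
  | nil => exact h
  | cons m ms ih =>
    rcases le_total t 1 with h1 | h1
    · rw [motion_cons_of_le _ _ _ h1]
      exact h.1 t ⟨h0, h1⟩
    · rw [motion_cons_of_ge _ _ _ h1]
      exact ih h.2 (by linarith)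

theorem motion_length (ms : List (Move n)) (P : Chain n) :
    motion ms P ms.length = perform ms P := by
  induction ms generalizing P with
  | nil => rfl
  | cons m ms ih =>
    have : (0 : ℝ) ≤ ms.length := Nat.cast_nonneg _
    rw [motion_cons_of_ge _ _ _ (by rw [List.length_cons]; push_cast; linarith)]
    simpa [perform] using ih (m.apply 1 P)

theorem StaysSimple.append {ms ms' : List (Move n)} {P : Chain n} (h : StaysSimple ms P)
    (h' : StaysSimple ms' (perform ms P)) : StaysSimple (ms ++ ms') P := by
  induction ms generalizing P with
  | nil => exact h'
  | cons m ms ih => exact ⟨h.1, ih h.2 h'⟩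

theorem StaysSimple.perform {ms : List (Move n)} {P : Chain n} (h : StaysSimple ms P) :
    (perform ms P).IsSimple := by
  induction ms generalizing P with
  | nil => exact h
  | cons m ms ih => exact ih h.2

theorem perform_append (ms ms' : List (Move n)) (P : Chain n) :
    perform (ms ++ ms') P = perform ms' (perform ms P) := by
  simp [perform]

theorem StaysSimple.isStraightening {ms : List (Move n)} {P : Chain n} (h : StaysSimple ms P)
    (hs : (_root_.perform ms P).IsStraight) :
    P.IsStraightening (ms.length : ℝ) (_root_.motion ms P) where
  continuousOn := (continuous_motion ms P).continuousOn
  start := motion_zero ms P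
  length t _ i := dist_motion ms P t i
  simple _ ht := h.motion ht.1
  straight := by rwa [motion_length]

end Motion

/-! ## Rods -/

/-- The vertices up to the `k`-th one lie in this order on a ray of direction `u` that ends at the
`k`-th vertex. -/
def Chain.Rod {n : ℕ} (P : Chain n) (k : Fin (n + 1)) (u : E4) : Prop :=
  ∀ i j : Fin (n + 1), i < j → j ≤ k → ∃ ρ > (0 : ℝ), P i = P j + ρ • u

namespace Chain.Rod

variable {n : ℕ} {P : Chain n} {k : Fin (n + 1)} {u : E4}

theorem exists_of_mem_edge (h : P.Rod k u) {i : Fin n} (hi : i.castSucc < k) {p : E4}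
    (hp : p ∈ P.edge i) : ∃ τ ≥ (0 : ℝ), p = P k + τ • u := by
  have aux : ∀ j ≤ k, ∃ τ ≥ (0 : ℝ), P j = P k + τ • u := by
    intro j hj
    rcases hj.lt_or_eq with hj | rfl
    · obtain ⟨ρ, h1, h2⟩ := h j k hj le_rfl
      exact ⟨ρ, h1.le, h2⟩
    · exact ⟨0, le_rfl, by simp⟩
  obtain ⟨σ, hσ, h1⟩ := aux _ hi.le
  obtain ⟨τ, hτ, h2⟩ := aux _ (Fin.castSucc_lt_iff_succ_le.1 hi)
  obtain ⟨α, β, hα, hβ, hαβ, rfl⟩ := hp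
  refine ⟨α * σ + β * τ, by positivity, ?_⟩
  rw [h1, h2]
  obtain rfl : β = 1 - α := by linarith
  module

theorem apply (h : P.Rod k u) (m : Move n) (s : ℝ) (hk : k ≤ m.joint) :
    (m.apply s P).Rod k (rotateLinear m.a m.b (s * m.angle) u) := by
  intro i j hij hj
  obtain ⟨ρ, hρ, h1⟩ := h i j hij hj
  refine ⟨ρ, hρ, ?_⟩
  rw [Move.apply_of_le _ _ _ (hij.le.trans (hj.trans hk)), Move.apply_of_le _ _ _ (hj.trans hk),
    ← map_smul, ← sub_eq_iff_eq_add', rotate_sub_rotate, h1, add_sub_cancel_left]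

theorem isStraight {P : Chain n} (h : P.Rod (Fin.last n) u) (hu : u ≠ 0) : P.IsStraight := by
  intro i j hij
  have hij' : i.castSucc < j.castSucc := Fin.lt_def.2 (by simp; omega)
  obtain ⟨ρ, hρ, h1⟩ := h _ _ hij' (Fin.le_last _)
  obtain ⟨σ, hσ, h2⟩ := h _ _ j.castSucc_lt_succ (Fin.le_last _)
  rw [EuclideanGeometry.angle, InnerProductGeometry.angle_eq_pi_iff]
  have e1 : P i.castSucc -ᵥ P j.castSucc = ρ • u := by rw [h1, vsub_eq_sub, add_sub_cancel_left]
  have e2 : P j.succ -ᵥ P j.castSucc = -σ • u := by rw [h2, vsub_eq_sub]; module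
  rw [e1, e2]
  refine ⟨smul_ne_zero hρ.ne' hu, -σ / ρ, div_neg_of_neg_of_pos (by linarith) hρ, ?_⟩
  rw [smul_smul, div_mul_cancel₀ _ hρ.ne']

end Chain.Rod

/-! ## Unit vectors and plane bases -/

/-- The unit vector of the direction of `x`. -/
noncomputable def unitVec (x : E4) : E4 := ‖x‖⁻¹ • x

theorem norm_unitVec {x : E4} (h : x ≠ 0) : ‖unitVec x‖ = 1 := by
  rw [unitVec, norm_smul, norm_inv, norm_norm, inv_mul_cancel₀ (norm_ne_zero_iff.2 h)]

theorem smul_unitVec {x : E4} (h : x ≠ 0) : ‖x‖ • unitVec x = x := by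
  rw [unitVec, smul_inv_smul₀ (norm_ne_zero_iff.2 h)]

/-- The unit vector that completes `u` to an orthonormal basis of the plane of `u` and `w`. -/
noncomputable def perp (u w : E4) : E4 := unitVec (w - (inner ℝ u w : ℝ) • u)

/-- The part of `w` orthogonal to `u` has squared norm `1 - cos² θ`, so its norm is `sin θ`; it is
nonzero as `w` is not a multiple of `u`, which keeps `θ` away from `0` and `π`. -/
theorem exists_angle {u w : E4} (hu : ‖u‖ = 1) (hw : ‖w‖ = 1) (h : ∀ α : ℝ, w ≠ α • u) :
    ‖perp u w‖ = 1 ∧ inner ℝ u (perp u w) = (0 : ℝ) ∧ ∃ θ, 0 < θ ∧ θ < Real.pi ∧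
      inner ℝ u w = Real.cos θ ∧ w = Real.cos θ • u + Real.sin θ • perp u w := by
  set c : ℝ := inner ℝ u w with hc
  have hr : w - c • u ≠ 0 := sub_ne_zero.2 (h c)
  have huu : inner ℝ u u = (1 : ℝ) := by rw [real_inner_self_eq_norm_sq, hu]; norm_num
  have hww : inner ℝ w w = (1 : ℝ) := by rw [real_inner_self_eq_norm_sq, hw]; norm_num
  have hn : ‖w - c • u‖ ^ 2 = 1 - c ^ 2 := by
    rw [← real_inner_self_eq_norm_sq]
    simp only [inner_sub_left, inner_sub_right, real_inner_smul_left, real_inner_smul_right,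
      huu, hww, real_inner_comm u w, ← hc]
    ring
  have hpos : 0 < ‖w - c • u‖ := norm_pos_iff.2 hr
  have hlt : c ^ 2 < 1 := by nlinarith
  have hc1 : -1 < c ∧ c < 1 := by constructor <;> nlinarith
  have hsin : Real.sin (Real.arccos c) = ‖w - c • u‖ := by
    rw [Real.sin_arccos, ← hn, Real.sqrt_sq hpos.le]
  have hcos : Real.cos (Real.arccos c) = c := Real.cos_arccos hc1.1.le hc1.2.le
  refine ⟨norm_unitVec hr, ?_, Real.arccos c, Real.arccos_pos.2 hc1.2, ?_, hcos.symm, ?_⟩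
  · rw [perp, unitVec, real_inner_smul_right, inner_sub_right, real_inner_smul_right, huu, ← hc]
    ring
  · refine (Real.arccos_le_pi c).lt_of_ne fun e => ?_
    rw [e, Real.cos_pi] at hcos
    linarith [hc1.1]
  · rw [hcos, hsin, perp, ← hc, smul_unitVec hr]
    abel

/-! ## Straightening one joint -/

namespace Move

variable {n : ℕ}

/-- A rod may be rotated about its end if it sweeps over no point of the rest of the chain. -/
theorem isSimple_apply_of_rod {m : Move n} {P : Chain n} (hP : P.IsSimple)
    (hrod : P.Rod m.joint m.a) {θ : ℝ} (h0 : 0 ≤ θ) (hpi : θ ≤ Real.pi) (hc : m.c = Real.cos θ)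
    (hfree : ∀ j : Fin n, m.joint ≤ j.castSucc → ∀ q ∈ P.edge j, ∀ χ τ : ℝ, 0 < χ → χ ≤ θ →
      0 < τ → q - P m.joint ≠ τ • (Real.cos χ • m.a + Real.sin χ • m.b))
    {s : ℝ} (hs : s ∈ Set.Icc (0 : ℝ) 1) : (m.apply s P).IsSimple := by
  have hangle : m.angle = θ := by rw [angle, hc, Real.arccos_cos h0 hpi]
  refine isSimple_apply m s P hP fun i j hi hj p hp q hq hpq => ?_
  obtain ⟨τ, hτ, rfl⟩ := hrod.exists_of_mem_edge hi hp
  have hχ : 0 ≤ s * m.angle := by rw [hangle]; exact mul_nonneg hs.1 h0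
  rcases hχ.eq_or_lt with hχ | hχ
  · rwa [← hχ, rotate_zero] at hpq
  rcases hτ.eq_or_lt with rfl | hτ
  · simpa using hpq
  refine absurd ?_ (hfree j hj q hq (s * m.angle) τ hχ ?_ hτ)
  · rw [← hpq, rotate_eq, add_sub_cancel_left, add_sub_cancel_left, map_smul]
    congr 1
    simpa using rotateLinear_plane m.norm_a m.norm_b m.orthogonal (s * m.angle) 1 0
  · rw [hangle]
    exact mul_le_of_le_one_left h0 hs.2

/-- The words that encode a move. -/
def words (j : ℕ) (a b : E4) (c : ℝ) : List (ℕ ⊕ ℝ) :=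
  [.inl j, .inr (a 0), .inr (a 1), .inr (a 2), .inr (a 3),
    .inr (b 0), .inr (b 1), .inr (b 2), .inr (b 3), .inr c]

end Move

/-- If `w` is in general position, three moves join the edge after a rod to the rod. -/
theorem exists_moves_of_rod {n : ℕ} {Q : Chain n} (hQ : Q.IsSimple) (k : Fin n) {a u w b : E4}
    {c c' s' : ℝ} (ha : ‖a‖ = 1) (hw : ‖w‖ = 1) (hrod : Q.Rod k.castSucc a)
    (hu : u = unitVec (Q k.castSucc - Q k.succ)) (hb : b = perp u w) (hc : c = inner ℝ u w)
    (hc' : c' = √((1 - c) / 2)) (hs' : s' = √((1 + c) / 2))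
    (hgen₀ : ∀ j : Fin n, k ≤ j → ∀ q ∈ Q.edge j, ∀ α β : ℝ,
      w ≠ α • a + β • (q - Q k.castSucc))
    (hgen : ∀ j : Fin n, k < j → ∀ q ∈ Q.edge j, ∀ α β : ℝ,
      w ≠ α • u + β • (q - Q k.castSucc)) :
    ∃ ms : List (Move n), ms.length = 3 ∧ StaysSimple ms Q ∧
      ms.flatMap Move.encode = Move.words k a (perp a w) (inner ℝ a w) ++
        Move.words (k + 1) u b c' ++ Move.words k (s' • b - c' • u) (s' • u + c' • b) c ∧
      (perform ms Q).Rod k.succ (c' • u + s' • b) ∧ ‖c' • u + s' • b‖ = 1 ∧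
      ∀ i, k.succ ≤ i → perform ms Q i = Q i := by
  have hne : Q k.castSucc - Q k.succ ≠ 0 := sub_ne_zero.2 (hQ.nondegenerate k)
  have hun : ‖u‖ = 1 := by rw [hu]; exact norm_unitVec hne
  obtain ⟨l, hl, hlu⟩ : ∃ l > (0 : ℝ), Q k.castSucc = Q k.succ + l • u :=
    ⟨‖Q k.castSucc - Q k.succ‖, norm_pos_iff.2 hne, by rw [hu, smul_unitVec hne]; abel⟩
  have hwa : ∀ α : ℝ, w ≠ α • a := fun α => by
    simpa using hgen₀ k le_rfl (Q k.castSucc) (left_mem_segment ℝ _ _) α 0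
  -- The end `v_{k+1}` of the edge is `-l • u` as seen from `v_k`.
  have hwu : ∀ α : ℝ, w ≠ α • u := fun α e => by
    refine hgen₀ k le_rfl (Q k.succ) (right_mem_segment ℝ _ _) 0 (-α / l) ?_
    rw [hlu, sub_add_cancel_left, smul_neg, smul_smul, div_mul_cancel₀ _ hl.ne', e]
    module
  obtain ⟨ha₁, ha₂, θ₁, hθ₁, hθ₁', hc₁, hwθ₁⟩ := exists_angle ha hw hwa
  obtain ⟨hb₁, hb₂, θ, hθ, hθ', hcθ, hwθ⟩ := exists_angle hun hw hwu
  rw [← hb] at hb₁ hb₂ hwθ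
  rw [← hc] at hcθ
  have hsin : 0 < Real.sin θ := Real.sin_pos_of_pos_of_lt_pi hθ hθ'
  rw [hcθ] at hc' hs'
  -- Thus `c' = sin (θ/2) = cos (π/2 - θ/2)` and `s' = cos (θ/2) = sin (π/2 - θ/2)`.
  rw [← Real.sin_half_eq_sqrt hθ.le (by linarith)] at hc'
  rw [← Real.cos_half (by linarith) hθ'.le] at hs'
  have hs'pos : 0 < s' := by
    rw [hs']; exact Real.cos_pos_of_mem_Ioo ⟨by linarith, by linarith⟩
  have hsq : c' ^ 2 + s' ^ 2 = 1 := by rw [hc', hs', Real.sin_sq_add_cos_sq]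
  have hbu : inner ℝ b u = (0 : ℝ) := by rw [real_inner_comm]; exact hb₂
  have huu : inner ℝ u u = (1 : ℝ) := by rw [real_inner_self_eq_norm_sq, hun]; norm_num
  have hbb : inner ℝ b b = (1 : ℝ) := by rw [real_inner_self_eq_norm_sq, hb₁]; norm_num
  have hnorm : ∀ x y : ℝ, x ^ 2 + y ^ 2 = 1 → ‖x • u + y • b‖ = 1 := fun x y h => by
    rw [← sq_eq_sq₀ (norm_nonneg _) zero_le_one, ← real_inner_self_eq_norm_sq]
    simp only [inner_add_left, inner_add_right, real_inner_smul_left, real_inner_smul_right,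
      huu, hbb, hbu, hb₂]
    linear_combination h
  -- A later point of the plane off the line of direction `u` would span the plane together with
  -- `u`, and so yield `w`.
  have hplane : ∀ j : Fin n, k < j → ∀ q ∈ Q.edge j, ∀ ξ η : ℝ,
      q - Q k.succ = ξ • u + η • b → η = 0 := by
    intro j hj q hq ξ η h
    by_contra hη
    refine hgen j hj q hq (Real.cos θ + Real.sin θ * η⁻¹ * (l - ξ)) (Real.sin θ * η⁻¹) ?_
    have : q - Q k.castSucc = (ξ - l) • u + η • b := by
      rw [hlu, ← sub_sub, h]; module
    rw [this, hwθ]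
    have e : (Real.sin θ * η⁻¹) * η = Real.sin θ := by field_simp
    rw [smul_add, smul_smul _ η, e]
    module
  have hk : k.castSucc < k.succ := k.castSucc_lt_succ
  -- the three moves
  let m₁ : Move n := ⟨k.castSucc, a, perp a w, Real.cos θ₁, ha, ha₁, ha₂, Real.neg_one_le_cos _,
    Real.cos_le_one _⟩
  let m₂ : Move n := ⟨k.succ, u, b, c', hun, hb₁, hb₂, by
    rw [hc']; exact Real.neg_one_le_sin _, by rw [hc']; exact Real.sin_le_one _⟩
  -- After move 2 the edge makes the angle `π/2 - θ/2` with `u` and the rod `π/2 + θ/2`. The second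
  -- basis vector is the first one turned clockwise, so the rod goes back towards the edge.
  let m₃ : Move n := ⟨k.castSucc, s' • b - c' • u, s' • u + c' • b, Real.cos θ, by
      rw [sub_eq_neg_add, ← neg_smul]
      exact hnorm _ _ (by linear_combination hsq), hnorm _ _ (by linear_combination hsq), by
      simp only [inner_add_right, inner_sub_left, real_inner_smul_left, real_inner_smul_right,
        huu, hbb, hbu, hb₂]
      ring, Real.neg_one_le_cos _, Real.cos_le_one _⟩
  have hang₁ : m₁.angle = θ₁ := Real.arccos_cos hθ₁.le hθ₁'.le
  have hang₃ : m₃.angle = θ := Real.arccos_cos hθ.le hθ'.le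
  have hang₂ : m₂.angle = Real.pi / 2 - θ / 2 := by
    change Real.arccos c' = _
    rw [hc', ← Real.cos_pi_div_two_sub, Real.arccos_cos (by linarith) (by linarith)]
  -- the positions after each move
  set Q₁ := m₁.apply 1 Q with hQ₁def
  set Q₂ := m₂.apply 1 Q₁ with hQ₂def
  set Q₃ := m₃.apply 1 Q₂ with hQ₃def
  have hQ₁ge : ∀ i, k.castSucc ≤ i → Q₁ i = Q i := fun i hi => m₁.apply_of_ge 1 Q hi
  have hQ₂ge : ∀ i, k.succ ≤ i → Q₂ i = Q i := fun i hi => by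
    rw [hQ₂def, m₂.apply_of_ge 1 Q₁ hi, hQ₁ge i (hk.le.trans hi)]
  have hQ₃ge : ∀ i, k.succ ≤ i → Q₃ i = Q i := fun i hi => by
    rw [hQ₃def, m₃.apply_of_ge 1 Q₂ (hk.le.trans hi), hQ₂ge i hi]
  have hedge₁ : ∀ j : Fin n, k ≤ j → Q₁.edge j = Q.edge j := fun j hj =>
    m₁.edge_apply_of_ge 1 Q hj
  have hedge₂ : ∀ j : Fin n, k < j → Q₂.edge j = Q.edge j := fun j hj => by
    rw [hQ₂def, m₂.edge_apply_of_ge 1 Q₁ (Fin.le_def.2 hj), hedge₁ j hj.le]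
  have simple₁ : ∀ s ∈ Set.Icc (0 : ℝ) 1, (m₁.apply s Q).IsSimple := by
    intro s hs
    refine Move.isSimple_apply_of_rod hQ hrod hθ₁.le hθ₁'.le rfl ?_ hs
    intro j hj q hq χ τ hχ hχ' hτ h
    have hsχ : 0 < Real.sin χ := Real.sin_pos_of_pos_of_lt_pi hχ (hχ'.trans_lt hθ₁')
    change q - Q k.castSucc = τ • (Real.cos χ • a + Real.sin χ • perp a w) at h
    -- As `sin χ ≠ 0`, the collision equation can be solved for `perp a w` and substituted into `w =
    -- cos θ₁ • a + sin θ₁ • perp a w`.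
    refine hgen₀ j hj q hq (Real.cos θ₁ - Real.sin θ₁ * (Real.sin χ)⁻¹ * Real.cos χ)
      (Real.sin θ₁ * (Real.sin χ)⁻¹ * τ⁻¹) ?_
    rw [h]
    conv_lhs => rw [hwθ₁]
    have e : Real.sin θ₁ * (Real.sin χ)⁻¹ * τ⁻¹ * τ = Real.sin θ₁ * (Real.sin χ)⁻¹ := by
      field_simp
    have e' : Real.sin θ₁ * (Real.sin χ)⁻¹ * Real.sin χ = Real.sin θ₁ := by field_simp
    rw [smul_smul, e, smul_add, smul_smul _ (Real.sin χ), e']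
    module
  have rod₁ : Q₁.Rod k.castSucc w := by
    have := hrod.apply m₁ 1 le_rfl
    rw [one_mul, hang₁] at this
    convert this using 1
    have := rotateLinear_plane ha ha₁ ha₂ θ₁ 1 0
    simp only [one_smul, zero_smul, add_zero, one_mul, zero_mul, sub_zero] at this
    rw [hwθ₁]
    exact this.symm
  have simple₂ : ∀ s ∈ Set.Icc (0 : ℝ) 1, (m₂.apply s Q₁).IsSimple := by
    intro s hs
    refine Move.isSimple_apply m₂ s Q₁ (simple₁ 1 (by simp)) ?_
    intro i j hi hj p hp q hq hpq
    change i.castSucc < k.succ at hi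
    have hj : k < j := hj
    rw [hedge₁ j hj.le] at hq
    have hjoint : Q₁ m₂.joint = Q k.succ := hQ₁ge _ hk.le
    rw [hjoint] at hpq
    -- The moving part lies in the cone of `u` and `w` at `v_{k+1}`: `μ = l` on the rod, `τ = 0` on
    -- the edge.
    obtain ⟨μ, τ, hμ, hτ, rfl⟩ : ∃ μ τ : ℝ, 0 ≤ μ ∧ 0 ≤ τ ∧
        p = Q k.succ + (μ • u + τ • w) := by
      rcases (Fin.le_castSucc_iff.2 hi).lt_or_eq with hik | hik
      · obtain ⟨τ, hτ, rfl⟩ := rod₁.exists_of_mem_edge hik hp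
        exact ⟨l, τ, hl.le, hτ, by rw [hQ₁ge _ le_rfl, hlu, add_assoc]⟩
      · obtain rfl := Fin.castSucc_injective _ hik
        rw [hedge₁ i le_rfl] at hp
        obtain ⟨x, y, hx, hy, hxy, rfl⟩ := hp
        refine ⟨x * l, 0, by positivity, le_rfl, ?_⟩
        rw [hlu]
        obtain rfl : y = 1 - x := by linarith
        module
    have hψ : 0 ≤ s * m₂.angle := mul_nonneg hs.1 (by rw [hang₂]; linarith)
    have hψ' : s * m₂.angle ≤ Real.pi / 2 - θ / 2 := by
      rw [← hang₂]
      exact mul_le_of_le_one_left (by rw [hang₂]; linarith) hs.2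
    generalize s * m₂.angle = ψ at *
    rcases hψ.eq_or_lt with rfl | hψ
    · rwa [rotate_zero] at hpq
    have h1 : 0 < Real.sin ψ := Real.sin_pos_of_pos_of_lt_pi hψ (by linarith)
    have h2 : 0 < Real.sin (θ + ψ) := Real.sin_pos_of_pos_of_lt_pi (by linarith) (by linarith)
    have e : μ • u + τ • w = (μ + τ * Real.cos θ) • u + (τ * Real.sin θ) • b := by
      rw [hwθ]; module
    have hq' := hpq
    rw [rotate_eq, add_sub_cancel_left, e] at hq'
    change Q k.succ + rotateLinear u b ψ _ = q at hq'
    rw [rotateLinear_plane hun hb₁ hb₂] at hq'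
    have := hplane j hj q hq _ _ (sub_eq_iff_eq_add'.2 hq'.symm)
    -- This is the `b`-coordinate of the rotated point. Both sines are positive because `0 < ψ` and
    -- `θ + ψ ≤ π/2 + θ/2 < π`, so only `v_{k+1}` itself can be hit.
    have h3 : μ * Real.sin ψ + τ * Real.sin (θ + ψ) = 0 := by
      rw [Real.sin_add]; linear_combination this
    have h4 : 0 ≤ μ * Real.sin ψ := by positivity
    have h5 : 0 ≤ τ * Real.sin (θ + ψ) := by positivity
    have h6 : μ = 0 := (mul_eq_zero.1 (by linarith : μ * Real.sin ψ = 0)).resolve_right h1.ne'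
    have h7 : τ = 0 :=
      (mul_eq_zero.1 (by linarith : τ * Real.sin (θ + ψ) = 0)).resolve_right h2.ne'
    simpa [h6, h7] using hpq
  have hrot₂ : ∀ ξ η : ℝ, rotateLinear m₂.a m₂.b (1 * m₂.angle) (ξ • u + η • b) =
      (ξ * c' - η * s') • u + (ξ * s' + η * c') • b := by
    intro ξ η
    rw [one_mul, hang₂]
    change rotateLinear u b _ _ = _
    rw [rotateLinear_plane hun hb₁ hb₂, Real.cos_pi_div_two_sub, Real.sin_pi_div_two_sub,
      ← hc', ← hs']
  have hQ₂k : Q₂ k.castSucc = Q k.succ + l • (c' • u + s' • b) := by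
    have h1 : Q₁ m₂.joint = Q k.succ := hQ₁ge _ hk.le
    rw [hQ₂def, m₂.apply_of_le 1 Q₁ hk.le, h1, hQ₁ge _ le_rfl, hlu, rotate_eq,
      add_sub_cancel_left]
    have := hrot₂ l 0
    rw [zero_smul, add_zero] at this
    rw [this]
    module
  have hcosθ : Real.cos θ = s' ^ 2 - c' ^ 2 := by
    rw [hc', hs', ← Real.cos_two_mul', mul_div_cancel₀ _ two_ne_zero]
  have hsinθ : Real.sin θ = 2 * c' * s' := by
    rw [hc', hs', ← Real.sin_two_mul, mul_div_cancel₀ _ two_ne_zero]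
  have rod₂ : Q₂.Rod k.castSucc (s' • b - c' • u) := by
    have := rod₁.apply m₂ 1 hk.le
    rw [hwθ, hrot₂, hcosθ, hsinθ] at this
    convert this using 1
    have e1 : (s' ^ 2 - c' ^ 2) * c' - 2 * c' * s' * s' = -c' := by
      linear_combination (-c') * hsq
    have e2 : (s' ^ 2 - c' ^ 2) * s' + 2 * c' * s' * c' = s' := by
      linear_combination s' * hsq
    rw [e1, e2]
    module
  have simple₃ : ∀ s ∈ Set.Icc (0 : ℝ) 1, (m₃.apply s Q₂).IsSimple := by
    intro s hs
    refine Move.isSimple_apply_of_rod (simple₂ 1 (by simp)) rod₂ hθ.le hθ'.le rfl ?_ hs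
    intro j hj q hq χ τ hχ hχ' hτ h
    change q - Q₂ k.castSucc =
      τ • (Real.cos χ • (s' • b - c' • u) + Real.sin χ • (s' • u + c' • b)) at h
    -- The `b`-coordinate of the rod's direction is `cos (χ - θ/2)`, and `χ - θ/2` stays within `θ/2
    -- < π/2` of `0`.
    have hpos : 0 < Real.cos χ * s' + Real.sin χ * c' := by
      rw [hc', hs', ← Real.cos_sub]
      exact Real.cos_pos_of_mem_Ioo ⟨by linarith, by linarith⟩
    have hpos' := mul_pos hτ hpos
    have hkj : k ≤ j := hj
    -- Later edges meet the plane only at height `0`, below the rod. The edge `k` descends from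
    -- `v_k`, whereas the rod ascends.
    rcases hkj.lt_or_eq with hkj | rfl
    · rw [hedge₂ j hkj] at hq
      have := hplane j hkj q hq
        (l * c' + τ * (Real.sin χ * s' - Real.cos χ * c'))
        (l * s' + τ * (Real.cos χ * s' + Real.sin χ * c')) (by
          rw [sub_eq_iff_eq_add.1 h, hQ₂k]; module)
      have := mul_pos hl hs'pos
      linarith
    · obtain ⟨x, y, hx, hy, hxy, rfl⟩ := hq
      change x • Q₂ k.castSucc + y • Q₂ k.succ - Q₂ k.castSucc = _ at h
      rw [hQ₂k, hQ₂ge _ le_rfl] at h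
      have h' := congrArg (fun v => inner ℝ b v) h
      obtain rfl : x = 1 - y := by linarith
      have e : (1 - y) • (Q k.succ + l • (c' • u + s' • b)) + y • Q k.succ -
          (Q k.succ + l • (c' • u + s' • b)) = (-y * l) • (c' • u + s' • b) := by module
      rw [e] at h'
      simp only [inner_add_right, inner_sub_right, real_inner_smul_right, hbb, hbu] at h'
      have := mul_nonneg (mul_nonneg hy hl.le) hs'pos.le
      linarith
  have rod₃ : Q₃.Rod k.castSucc (c' • u + s' • b) := by
    have := rod₂.apply m₃ 1 le_rfl
    have e := rotateLinear_plane m₃.norm_a m₃.norm_b m₃.orthogonal θ 1 0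
    rw [one_mul, hang₃] at this
    rw [one_smul, zero_smul, add_zero] at e
    change rotateLinear m₃.a m₃.b θ (s' • b - c' • u) =
      _ • (s' • b - c' • u) + _ • (s' • u + c' • b) at e
    rw [e, hcosθ, hsinθ] at this
    convert this using 1
    simp only [one_mul, zero_mul, sub_zero, add_zero]
    have e1 : c' = 2 * c' * s' * s' - (s' ^ 2 - c' ^ 2) * c' := by
      linear_combination (-c') * hsq
    have e2 : s' = (s' ^ 2 - c' ^ 2) * s' + 2 * c' * s' * c' := by
      linear_combination (-s') * hsq
    refine (congrArg₂ (fun x y : ℝ => x • u + y • b) e1 e2).trans ?_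
    module
  have hQ₃k : Q₃ k.castSucc = Q₃ k.succ + l • (c' • u + s' • b) := by
    rw [hQ₃ge _ le_rfl, ← hQ₂k, hQ₃def, m₃.apply_of_ge 1 Q₂ le_rfl]
  refine ⟨[m₁, m₂, m₃], rfl, ⟨simple₁, simple₂, simple₃, simple₃ 1 (by simp)⟩, ?_, ?_,
    hnorm _ _ hsq, hQ₃ge⟩
  · rw [hc₁, hcθ]
    rfl
  · intro i j hij hj
    change ∃ ρ > (0 : ℝ), Q₃ i = Q₃ j + ρ • _
    rcases hj.lt_or_eq with hj | rfl
    · exact rod₃ i j hij (Fin.le_castSucc_iff.2 hj)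
    · rcases (Fin.le_castSucc_iff.2 hij).lt_or_eq with hik | rfl
      · obtain ⟨ρ, hρ, h⟩ := rod₃ i _ hik le_rfl
        refine ⟨ρ + l, by positivity, ?_⟩
        rw [h, hQ₃k]
        module
      · exact ⟨l, hl, hQ₃k⟩

/-! ## General position -/

/-- The twisted curve of degree three. -/
def twistedCurve (t : ℝ) : Fin 4 → ℝ := ![1, t, t ^ 2, t ^ 3]

section Cross

variable {α : Type*} [Add α] [Sub α] [Mul α]

/-- The minor of the rows `x`, `y`, `z` in the columns `i`, `j`, `k`. -/
def minor (x y z : Fin 4 → α) (i j k : Fin 4) : α :=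
  x i * (y j * z k - y k * z j) - x j * (y i * z k - y k * z i) + x k * (y i * z j - y j * z i)

/-- The ternary cross product in dimension four. -/
def cross (x y z : Fin 4 → α) : Fin 4 → α :=
  ![minor x y z 2 1 3, minor x y z 0 2 3, minor x y z 1 0 3, minor x y z 0 1 2]

/-- The dot product in dimension four. -/
def dot (x y : Fin 4 → α) : α := x 0 * y 0 + x 1 * y 1 + x 2 * y 2 + x 3 * y 3

/-- Normals of hyperplanes one of which contains `x`, `y`, `z` if `x ≠ 0`; here `e` is the
standard basis. -/
def normals (e : Fin 4 → Fin 4 → α) (x y z : Fin 4 → α) : List (Fin 4 → α) :=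
  cross x y z :: ((List.finRange 4).map fun i => cross x y (e i)) ++
    ((List.finRange 4).map fun i => cross x z (e i)) ++
    (List.finRange 4).flatMap fun i => (List.finRange 4).map fun j => cross x (e i) (e j)

end Cross

/-- The standard basis of four-space. -/
def stdBasis (i j : Fin 4) : ℝ := if i = j then 1 else 0

theorem dot_add_smul (N x y z : Fin 4 → ℝ) (α β γ : ℝ) :
    dot N (α • x + β • y + γ • z) = α * dot N x + β * dot N y + γ * dot N z := by
  simp only [dot, Pi.add_apply, Pi.smul_apply, smul_eq_mul]
  ring

theorem dot_cross_first (x y z : Fin 4 → ℝ) : dot (cross x y z) x = 0 := by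
  simp [dot, cross, minor]; ring

theorem dot_cross_second (x y z : Fin 4 → ℝ) : dot (cross x y z) y = 0 := by
  simp [dot, cross, minor]; ring

theorem dot_cross_third (x y z : Fin 4 → ℝ) : dot (cross x y z) z = 0 := by
  simp [dot, cross, minor]; ring

theorem dot_cross_swap (x y z w : Fin 4 → ℝ) :
    dot (cross x y z) w = -dot (cross x y w) z := by
  simp [dot, cross, minor]; ring

theorem dot_cross_rotate (x y z w : Fin 4 → ℝ) :
    dot (cross x y z) w = dot (cross x w y) z := by
  simp [dot, cross, minor]; ring

theorem eq_zero_of_cross_stdBasis {x : Fin 4 → ℝ}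
    (h : ∀ i j, cross x (stdBasis i) (stdBasis j) = 0) : x = 0 := by
  have h1 := h 0 1
  have h2 := h 2 3
  funext i
  have e1 := congrFun h1 2
  have e2 := congrFun h1 3
  have e3 := congrFun h2 0
  have e4 := congrFun h2 1
  simp [cross, minor, stdBasis] at e1 e2 e3 e4
  fin_cases i <;> simp [*]

/-- If `c` were in the span, every listed vector orthogonal to `x`, `y`, `z` would have to vanish.
Vanishing of `cross x y z` makes the vectors `cross x y eᵢ` and `cross x z eᵢ` orthogonal to all
three, so they vanish; then the same holds for `cross x eᵢ eⱼ`, which forces `x = 0`. -/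
theorem not_mem_span_of_normals {x y z c : Fin 4 → ℝ} (hx : x ≠ 0)
    (h : ∀ N ∈ normals stdBasis x y z, N ≠ 0 → dot N c ≠ 0) (α β γ : ℝ) :
    c ≠ α • x + β • y + γ • z := by
  rintro rfl
  simp only [normals, List.mem_append, List.mem_cons, List.mem_map, List.mem_flatMap,
    List.mem_finRange, true_and] at h
  have key : ∀ N : Fin 4 → ℝ, dot N x = 0 → dot N y = 0 → dot N z = 0 →
      dot N (α • x + β • y + γ • z) = 0 := fun N h1 h2 h3 => by
    rw [dot_add_smul, h1, h2, h3]; ring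
  have h0 : cross x y z = 0 := by
    by_contra h0
    exact h _ (.inl (.inl (.inl rfl))) h0
      (key _ (dot_cross_first _ _ _) (dot_cross_second _ _ _) (dot_cross_third _ _ _))
  have h1 : ∀ i, cross x y (stdBasis i) = 0 := fun i => by
    by_contra h1
    refine h _ (.inl (.inl (.inr ⟨i, rfl⟩))) h1
      (key _ (dot_cross_first _ _ _) (dot_cross_second _ _ _) ?_)
    rw [dot_cross_swap, h0]
    simp [dot]
  have h2 : ∀ i, cross x z (stdBasis i) = 0 := fun i => by
    by_contra h2
    refine h _ (.inl (.inr ⟨i, rfl⟩)) h2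
      (key _ (dot_cross_first _ _ _) ?_ (dot_cross_second _ _ _))
    rw [dot_cross_rotate, h0]
    simp [dot]
  refine hx (eq_zero_of_cross_stdBasis fun i j => ?_)
  by_contra h3
  refine h _ (.inr ⟨i, j, rfl⟩) h3 (key _ (dot_cross_first _ _ _) ?_ ?_)
  · rw [dot_cross_rotate, h1]
    simp [dot]
  · rw [dot_cross_rotate, h2]
    simp [dot]

/-- Cauchy's root bound: each coefficient is at least `-(t - 1)`, and `t³ - (t - 1)(1 + t + t²) =
1`. Squares avoid absolute values and roots. -/
theorem cubic_pos {a b c t : ℝ} (ht : 2 ≤ t) (ha : a ^ 2 ≤ t - 2) (hb : b ^ 2 ≤ t - 2)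
    (hc : c ^ 2 ≤ t - 2) : 0 < a + b * t + c * t ^ 2 + t ^ 3 := by
  have aux : ∀ r : ℝ, r ^ 2 ≤ t - 2 → 0 ≤ r + (t - 1) := fun r hr => by
    nlinarith [sq_nonneg (r + 1)]
  have h1 := aux a ha
  have h2 := mul_nonneg (aux b hb) (by linarith : 0 ≤ t)
  have h3 := mul_nonneg (aux c hc) (sq_nonneg t)
  nlinarith

/-- The twisted curve leaves a hyperplane for good before this bound on its parameter. -/
theorem dot_twistedCurve_ne_zero {N : Fin 4 → ℝ} (hN : N ≠ 0) {t : ℝ}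
    (ht : ∀ l, 2 + dot N N / (N l * N l) ≤ t) : dot N (twistedCurve t) ≠ 0 := by
  have hdiv : ∀ l i, N l ≠ 0 → (N i / N l) ^ 2 ≤ t - 2 := fun l i hl => by
    have h1 : N i ^ 2 ≤ dot N N := by
      simp only [dot]
      fin_cases i <;> simp <;>
        nlinarith [sq_nonneg (N 0), sq_nonneg (N 1), sq_nonneg (N 2), sq_nonneg (N 3)]
    have h2 : 0 < N l * N l := mul_self_pos.2 hl
    have h3 : (N i / N l) ^ 2 ≤ dot N N / (N l * N l) := by
      rw [div_pow, ← sq]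
      gcongr
    linarith [ht l]
  have h2t : 2 ≤ t := by
    have h1 : 0 ≤ dot N N / (N 0 * N 0) := by
      refine div_nonneg ?_ (mul_self_nonneg _)
      simp only [dot]
      nlinarith [sq_nonneg (N 0), sq_nonneg (N 1), sq_nonneg (N 2), sq_nonneg (N 3)]
    linarith [ht 0]
  have hz : (0 : ℝ) ^ 2 ≤ t - 2 := by linarith
  intro h
  simp [dot, twistedCurve] at h
  -- Divide by the top nonzero coefficient and multiply by a power of `t`, so that a monic cubic
  -- results in each case.
  by_cases h3 : N 3 = 0
  · by_cases h2 : N 2 = 0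
    · by_cases h1 : N 1 = 0
      · refine hN (funext fun i => ?_)
        rw [h3, h2, h1] at h
        fin_cases i <;> simp [*]
        simpa using h
      · have := cubic_pos h2t hz hz (hdiv 1 0 h1)
        have e : 0 + 0 * t + N 0 / N 1 * t ^ 2 + t ^ 3 =
            t ^ 2 / N 1 * (N 0 + N 1 * t + N 2 * t ^ 2 + N 3 * t ^ 3) := by
          rw [h3, h2]; field_simp; ring
        rw [e, h, mul_zero] at this
        exact this.false
    · have := cubic_pos h2t hz (hdiv 2 0 h2) (hdiv 2 1 h2)
      have e : 0 + N 0 / N 2 * t + N 1 / N 2 * t ^ 2 + t ^ 3 =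
          t / N 2 * (N 0 + N 1 * t + N 2 * t ^ 2 + N 3 * t ^ 3) := by
        rw [h3]; field_simp; ring
      rw [e, h, mul_zero] at this
      exact this.false
  · have := cubic_pos h2t (hdiv 3 0 h3) (hdiv 3 1 h3) (hdiv 3 2 h3)
    have e : N 0 / N 3 + N 1 / N 3 * t + N 2 / N 3 * t ^ 2 + t ^ 3 =
        1 / N 3 * (N 0 + N 1 * t + N 2 * t ^ 2 + N 3 * t ^ 3) := by
      field_simp
    rw [e, h, mul_zero] at this
    exact this.false

/-- From the parameter `T` on, the twisted curve does not meet the span of `x`, `y`, `z`. -/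
def Escapes (x y z : Fin 4 → ℝ) (T : ℝ) : Prop :=
  ∀ t ≥ T, ∀ α β γ : ℝ, twistedCurve t ≠ α • x + β • y + γ • z

theorem Escapes.mono {x y z : Fin 4 → ℝ} {T T' : ℝ} (h : Escapes x y z T) (hT : T ≤ T') :
    Escapes x y z T' := fun t ht => h t (hT.trans ht)

/-- The contribution of the hyperplane with normal `N` to the bound on the parameter. -/
noncomputable def escapeBound (N : Fin 4 → ℝ) : ℝ :=
  dot N N / (N 0 * N 0) + dot N N / (N 1 * N 1) + dot N N / (N 2 * N 2) + dot N N / (N 3 * N 3)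

theorem dot_self_nonneg (x : Fin 4 → ℝ) : 0 ≤ dot x x := by
  unfold dot
  have := mul_self_nonneg (x 0)
  have := mul_self_nonneg (x 1)
  have := mul_self_nonneg (x 2)
  have := mul_self_nonneg (x 3)
  positivity

theorem escapeBound_nonneg (N : Fin 4 → ℝ) : 0 ≤ escapeBound N := by
  have h : ∀ l, 0 ≤ dot N N / (N l * N l) := fun l =>
    div_nonneg (dot_self_nonneg N) (mul_self_nonneg _)
  unfold escapeBound
  linarith [h 0, h 1, h 2, h 3]

/-- The quotients in `escapeBound` are nonnegative, so their sum dominates each; a zero coordinate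
contributes `0` by the convention for division. -/
theorem escapes_of_le {x y z : Fin 4 → ℝ} (hx : x ≠ 0) {T : ℝ}
    (hT : ∀ N ∈ normals stdBasis x y z, 2 + escapeBound N ≤ T) : Escapes x y z T := by
  intro t ht α β γ
  refine not_mem_span_of_normals hx (fun N hN hN0 => dot_twistedCurve_ne_zero hN0 fun l => ?_)
    α β γ
  have h1 := hT N hN
  have h : ∀ l, 0 ≤ dot N N / (N l * N l) := fun l =>
    div_nonneg (dot_self_nonneg N) (mul_self_nonneg _)
  unfold escapeBound at h1
  have h0' := h 0
  have h1' := h 1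
  have h2' := h 2
  have h3' := h 3
  fin_cases l <;> simp only [Fin.zero_eta, Fin.mk_one, Fin.reduceFinMk] <;> linarith

/-! ## Reasoning about programs -/

namespace RealRAM

/-- Together with the next three instances, this lets `dot`, `cross` and `normals`, which presuppose
no ring axioms, produce program text and real values from one formula. -/
instance : Add RExp := ⟨.add⟩
instance : Sub RExp := ⟨.sub⟩
instance : Mul RExp := ⟨.mul⟩
instance : Div RExp := ⟨.div⟩

/-- Expressions for vectors. -/
abbrev VExp : Type := Fin 4 → RExp

/-- In the state `s` the expression `e` is defined and has the value `x`. -/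
def RExp.Computes (N : ℕ) (s : State) (e : RExp) (x : ℝ) : Prop := e.Defined N s ∧ e.eval s = x

/-- In the state `s` the vector expression `V` is defined and has the value `v`. -/
def VExp.Computes (N : ℕ) (s : State) (V : VExp) (v : Fin 4 → ℝ) : Prop :=
  ∀ i, (V i).Computes N s (v i)

namespace RExp.Computes

variable {N : ℕ} {s : State} {e f : RExp} {x y : ℝ}

theorem const (z : ℤ) : (RExp.const z).Computes N s z := ⟨trivial, rfl⟩

theorem var (i : ℕ) : (RExp.var i).Computes N s (s.reg i) := ⟨trivial, rfl⟩

theorem add (he : e.Computes N s x) (hf : f.Computes N s y) : (e + f).Computes N s (x + y) :=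
  ⟨⟨he.1, hf.1⟩, congrArg₂ (· + ·) he.2 hf.2⟩

theorem sub (he : e.Computes N s x) (hf : f.Computes N s y) : (e - f).Computes N s (x - y) :=
  ⟨⟨he.1, hf.1⟩, congrArg₂ (· - ·) he.2 hf.2⟩

theorem mul (he : e.Computes N s x) (hf : f.Computes N s y) : (e * f).Computes N s (x * y) :=
  ⟨⟨he.1, hf.1⟩, congrArg₂ (· * ·) he.2 hf.2⟩

theorem div (he : e.Computes N s x) (hf : f.Computes N s y) (hy : y ≠ 0) :
    (e / f).Computes N s (x / y) :=
  ⟨⟨he.1, hf.1, by rw [hf.2]; exact hy⟩, congrArg₂ (· / ·) he.2 hf.2⟩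

theorem sqrt (he : e.Computes N s x) (hx : 0 ≤ x) : (RExp.sqrt e).Computes N s √x :=
  ⟨⟨he.1, by rw [he.2]; exact hx⟩, congrArg Real.sqrt he.2⟩

end RExp.Computes

theorem NExp.eval_out (s : State) (o : List (ℕ ⊕ ℝ)) (e : NExp) :
    e.eval { s with out := o } = e.eval s := by
  induction e with
  | const _ => rfl
  | var _ => rfl
  | succ e ih => simp only [NExp.eval, ih]
  | pred e ih => simp only [NExp.eval, ih]

theorem RExp.eval_out (s : State) (o : List (ℕ ⊕ ℝ)) (e : RExp) :
    e.eval { s with out := o } = e.eval s := by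
  induction e <;> simp_all only [RExp.eval, NExp.eval_out]

theorem RExp.defined_out (N : ℕ) (s : State) (o : List (ℕ ⊕ ℝ)) (e : RExp) :
    e.Defined N { s with out := o } ↔ e.Defined N s := by
  induction e <;> simp_all only [RExp.Defined, NExp.eval_out, RExp.eval_out]

theorem RExp.Computes.of_out {N : ℕ} {s : State} {e : RExp} {x : ℝ} (h : e.Computes N s x)
    (o : List (ℕ ⊕ ℝ)) : e.Computes N { s with out := o } x :=
  ⟨(RExp.defined_out N s o e).2 h.1, (RExp.eval_out s o e).trans h.2⟩

/-! ### Values of vector expressions -/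

namespace VExp

variable {N : ℕ} {s : State} {V W X Y Z : VExp} {v w x y z : Fin 4 → ℝ}

theorem Computes.dot (hV : V.Computes N s v) (hW : W.Computes N s w) :
    RExp.Computes N s (dot V W) (_root_.dot v w) :=
  ((((hV 0).mul (hW 0)).add ((hV 1).mul (hW 1))).add ((hV 2).mul (hW 2))).add
    ((hV 3).mul (hW 3))

theorem Computes.minor (hX : X.Computes N s x) (hY : Y.Computes N s y) (hZ : Z.Computes N s z)
    (i j k : Fin 4) : RExp.Computes N s (minor X Y Z i j k) (_root_.minor x y z i j k) :=
  (((hX i).mul (((hY j).mul (hZ k)).sub ((hY k).mul (hZ j)))).sub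
    ((hX j).mul (((hY i).mul (hZ k)).sub ((hY k).mul (hZ i))))).add
    ((hX k).mul (((hY i).mul (hZ j)).sub ((hY j).mul (hZ i))))

theorem Computes.cross (hX : X.Computes N s x) (hY : Y.Computes N s y) (hZ : Z.Computes N s z) :
    VExp.Computes N s (cross X Y Z) (_root_.cross x y z) := by
  intro i
  fin_cases i <;> exact Computes.minor hX hY hZ _ _ _

/-- The expression for the unit vector of the direction of a vector. -/
def unit (V : VExp) : VExp := fun i => V i / RExp.sqrt (_root_.dot V V)

/-- The expression for `perp`. -/
def perp (V W : VExp) : VExp := unit fun i => W i - _root_.dot V W * V i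

/-- The expression for a linear combination of two vectors. -/
def comb (e : RExp) (V : VExp) (f : RExp) (W : VExp) : VExp := fun i => e * V i + f * W i

theorem Computes.inner {p q : E4} (hV : V.Computes N s p.ofLp) (hW : W.Computes N s q.ofLp) :
    RExp.Computes N s (_root_.dot V W) (Inner.inner ℝ p q) := by
  have h : (Inner.inner ℝ p q : ℝ) = _root_.dot p.ofLp q.ofLp := by
    rw [PiLp.inner_apply, Fin.sum_univ_four]
    simp [_root_.dot, mul_comm]
  rw [h]
  exact hV.dot hW

theorem Computes.unit {p : E4} (hp : p ≠ 0) (hV : V.Computes N s p.ofLp) :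
    V.unit.Computes N s (unitVec p).ofLp := by
  intro i
  have h1 := hV.inner hV
  rw [real_inner_self_eq_norm_sq] at h1
  have h2 := h1.sqrt (sq_nonneg _)
  rw [Real.sqrt_sq (norm_nonneg _)] at h2
  have h3 : (unitVec p).ofLp i = p i / ‖p‖ := by simp [unitVec, div_eq_inv_mul]
  rw [h3]
  exact (hV i).div h2 (norm_ne_zero_iff.2 hp)

theorem Computes.perp {p q : E4} (hV : V.Computes N s p.ofLp) (hW : W.Computes N s q.ofLp)
    (h : ∀ α : ℝ, q ≠ α • p) : (V.perp W).Computes N s (_root_.perp p q).ofLp :=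
  Computes.unit (sub_ne_zero.2 (h _)) fun i => (hW i).sub ((hV.inner hW).mul (hV i))

theorem Computes.comb {p q : E4} {e f : RExp} {α β : ℝ} (he : e.Computes N s α)
    (hV : V.Computes N s p.ofLp) (hf : f.Computes N s β) (hW : W.Computes N s q.ofLp) :
    (comb e V f W).Computes N s (α • p + β • q).ofLp :=
  fun i => (he.mul (hV i)).add (hf.mul (hW i))

end VExp

/-- A program without loops. -/
def Prog.LoopFree : Prog → Prop
  | .seq p q => p.LoopFree ∧ q.LoopFree
  | .ite _ p q => p.LoopFree ∧ q.LoopFree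
  | .while _ _ => False
  | _ => True

/-- A bound on the number of steps of a program without loops. -/
def Prog.bound : Prog → ℕ
  | .skip => 1
  | .setIdx _ e => e.cost + 1
  | .setReg _ e => e.cost + 1
  | .setArr _ e f => e.cost + f.cost + 1
  | .writeIdx e => e.cost + 1
  | .writeReal e => e.cost + 1
  | .seq p q => p.bound + q.bound
  | .ite b p q => b.cost + (p.bound + q.bound) + 1
  | .while _ _ => 0

/-- The bound depends on the program text alone, so correctness proofs for loop-free parts can
ignore time. -/
theorem Exec.time_le {N : ℕ} {p : Prog} {s s' : State} {t : ℕ} (h : Exec N p s t s')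
    (hp : p.LoopFree) : t ≤ p.bound := by
  induction h with
  | seq _ _ ih₁ ih₂ => exact Nat.add_le_add (ih₁ hp.1) (ih₂ hp.2)
  | ite_true _ _ _ ih => have := ih hp.1; simp only [Prog.bound]; omega
  | ite_false _ _ _ ih => have := ih hp.2; simp only [Prog.bound]; omega
  | while_true => exact hp.elim
  | while_false => exact hp.elim
  | _ => exact le_rfl

/-- The program `p` started in the state `s` halts in the state `s'`. -/
def Runs (N : ℕ) (p : Prog) (s s' : State) : Prop := ∃ t, Exec N p s t s'

theorem Runs.seq {N : ℕ} {p q : Prog} {s s' s'' : State} (hp : Runs N p s s')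
    (hq : Runs N q s' s'') : Runs N (.seq p q) s s'' := by
  obtain ⟨t, ht⟩ := hp
  obtain ⟨t', ht'⟩ := hq
  exact ⟨_, ht.seq ht'⟩

theorem Runs.exec {N : ℕ} {p : Prog} {s s' : State} (h : Runs N p s s') (hp : p.LoopFree) :
    ∃ t ≤ p.bound, Exec N p s t s' := by
  obtain ⟨t, ht⟩ := h
  exact ⟨t, ht.time_le hp, ht⟩

theorem runs_setReg {N : ℕ} {s : State} {e : RExp} {x : ℝ} (i : ℕ) (h : e.Computes N s x) :
    Runs N (.setReg i e) s { s with reg := Function.update s.reg i x } := by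
  obtain ⟨h1, rfl⟩ := h
  exact ⟨_, Exec.setReg i e s h1⟩

theorem runs_writeReal {N : ℕ} {s : State} {e : RExp} {x : ℝ} (h : e.Computes N s x) :
    Runs N (.writeReal e) s { s with out := s.out ++ [.inr x] } := by
  obtain ⟨h1, rfl⟩ := h
  exact ⟨_, Exec.writeReal e s h1⟩

/-- A loop with an invariant that counts the remaining iterations. -/
theorem exec_while {N : ℕ} {b : BExp} {p : Prog} {K : ℕ} (Inv : ℕ → State → Prop)
    (body : ∀ m s, Inv (m + 1) s → b.Defined N s ∧ b.Holds s ∧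
      ∃ s' t, Exec N p s t s' ∧ t ≤ K ∧ Inv m s')
    (exit : ∀ s, Inv 0 s → b.Defined N s ∧ ¬ b.Holds s) (m : ℕ) (s : State) (h : Inv m s) :
    ∃ s' t, Exec N (.while b p) s t s' ∧ t ≤ (m + 1) * (b.cost + K + 1) ∧ Inv 0 s' := by
  induction m generalizing s with
  | zero =>
    obtain ⟨h1, h2⟩ := exit s h
    exact ⟨s, _, Exec.while_false h1 h2, by omega, h⟩
  | succ m ih =>
    obtain ⟨h1, h2, s', t, h3, h4, h5⟩ := body m s h
    obtain ⟨s'', t', h6, h7, h8⟩ := ih s' h5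
    refine ⟨s'', _, Exec.while_true h1 h2 h3 h6, ?_, h8⟩
    rw [add_mul (m + 1), one_mul]
    omega

/-! ## Output of moves -/

/-- Write a vector. -/
def writeVec (V : VExp) : Prog :=
  .seq (.seq (.writeReal (V 0)) (.writeReal (V 1))) (.seq (.writeReal (V 2)) (.writeReal (V 3)))

/-- Write a move. -/
def writeMove (e : NExp) (A B : VExp) (c : RExp) : Prog :=
  .seq (.writeIdx e) (.seq (writeVec A) (.seq (writeVec B) (.writeReal c)))

theorem runs_writeVec {N : ℕ} {s : State} {V : VExp} {v : Fin 4 → ℝ} (h : V.Computes N s v) :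
    Runs N (writeVec V) s
      { s with out := s.out ++ [.inr (v 0), .inr (v 1), .inr (v 2), .inr (v 3)] } := by
  have := ((runs_writeReal (h 0)).seq (runs_writeReal ((h 1).of_out _))).seq
    ((runs_writeReal ((h 2).of_out _)).seq (runs_writeReal ((h 3).of_out _)))
  simpa [writeVec] using this

theorem runs_writeMove {N : ℕ} {s : State} {e : NExp} {j : ℕ} {A B : VExp} {a b : E4} {f : RExp}
    {c : ℝ} (hj : e.eval s = j) (hA : A.Computes N s a.ofLp) (hB : B.Computes N s b.ofLp)
    (hc : f.Computes N s c) :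
    Runs N (writeMove e A B f) s { s with out := s.out ++ Move.words j a b c } := by
  have h1 : Runs N (.writeIdx e) s { s with out := s.out ++ [.inl j] } := by
    rw [← hj]
    exact ⟨_, Exec.writeIdx e s⟩
  have := h1.seq ((runs_writeVec fun i => (hA i).of_out _).seq
    ((runs_writeVec fun i => (hB i).of_out _).seq (runs_writeReal (hc.of_out _))))
  simpa [Move.words, writeMove] using this

/-! ## The search for a vector in general position -/

/-- The state with the index variable `2` set to `j` and the real variable `4` set to `T`. -/
noncomputable def State.scan (s : State) (j : ℕ) (T : ℝ) : State :=
  { s with idx := Function.update s.idx 2 j, reg := Function.update s.reg 4 T }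

/-- Add to the real variable `4` the bound that belongs to one coordinate of a normal. -/
def raiseCoord (V : VExp) (l : Fin 4) : Prog :=
  .ite (.rlt (.const 0) (V l * V l)) (.setReg 4 (.var 4 + dot V V / (V l * V l))) .skip

/-- Add to the real variable `4` the bound that belongs to a normal. -/
def raiseNormal (V : VExp) : Prog :=
  .seq (.seq (.seq (raiseCoord V 0) (raiseCoord V 1)) (raiseCoord V 2)) (raiseCoord V 3)

/-- Add to the real variable `4` the bounds that belong to a list of normals. -/
def raiseNormals : List VExp → Prog
  | [] => .skip
  | V :: Vs => .seq (raiseNormal V) (raiseNormals Vs)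

/-- The standard basis as expressions. -/
def basisExp (i j : Fin 4) : RExp := if i = j then .const 1 else .const 0

/-- Raise the real variable `4` until the twisted curve has left the span of three vectors. -/
def raise (X Y Z : VExp) : Prog := raiseNormals (normals basisExp X Y Z)

theorem loopFree_raiseNormals (Vs : List VExp) : (raiseNormals Vs).LoopFree := by
  induction Vs with
  | nil => trivial
  | cons V Vs ih => exact ⟨by simp [raiseNormal, raiseCoord, Prog.LoopFree], ih⟩

theorem loopFree_raise (X Y Z : VExp) : (raise X Y Z).LoopFree := loopFree_raiseNormals _

section Raise

variable {N : ℕ} {s : State} {j : ℕ}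

theorem runs_raiseCoord {V : VExp} {v : Fin 4 → ℝ} {T : ℝ} (h : V.Computes N (s.scan j T) v)
    (l : Fin 4) :
    Runs N (raiseCoord V l) (s.scan j T) (s.scan j (T + dot v v / (v l * v l))) := by
  have hl := (h l).mul (h l)
  have hd : (BExp.rlt (.const 0) (V l * V l)).Defined N (s.scan j T) := ⟨trivial, hl.1⟩
  have hb : (BExp.rlt (.const 0) (V l * V l)).Holds (s.scan j T) ↔ 0 < v l * v l := by
    simp only [BExp.Holds, hl.2]
    simp [RExp.eval]
  by_cases h0 : 0 < v l * v l
  · have hT : (RExp.var 4).Computes N (s.scan j T) T := ⟨trivial, by simp [RExp.eval, State.scan]⟩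
    obtain ⟨t, ht⟩ := runs_setReg 4 (hT.add ((h.dot h).div hl h0.ne'))
    have hs : ({ s.scan j T with
        reg := Function.update (s.scan j T).reg 4 (T + dot v v / (v l * v l)) } : State) =
          s.scan j (T + dot v v / (v l * v l)) := by
      simp [State.scan]
    rw [hs] at ht
    exact ⟨_, Exec.ite_true hd (hb.2 h0) ht⟩
  -- Skipping agrees with the value `0` of division by zero in `escapeBound`.
  · have h1 : v l * v l = 0 := le_antisymm (not_lt.1 h0) (mul_self_nonneg _)
    rw [h1, div_zero, add_zero]
    exact ⟨_, Exec.ite_false hd (fun h => h0 (hb.1 h)) (Exec.skip _)⟩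

theorem runs_raiseNormal {V : VExp} {v : Fin 4 → ℝ} (h : ∀ T, V.Computes N (s.scan j T) v)
    (T : ℝ) : Runs N (raiseNormal V) (s.scan j T) (s.scan j (T + escapeBound v)) := by
  have := (((runs_raiseCoord (h T) 0).seq (runs_raiseCoord (h _) 1)).seq
    (runs_raiseCoord (h _) 2)).seq (runs_raiseCoord (h _) 3)
  simp only [add_assoc] at this
  simpa only [raiseNormal, escapeBound, add_assoc] using this

/-- The values are required for every `T` because the register `4` changes between evaluations. -/
theorem runs_raiseNormals {Vs : List VExp} {vs : List (Fin 4 → ℝ)}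
    (h : List.Forall₂ (fun V v => ∀ T, VExp.Computes N (s.scan j T) V v) Vs vs) (T : ℝ) :
    Runs N (raiseNormals Vs) (s.scan j T) (s.scan j (T + (vs.map escapeBound).sum)) := by
  induction h generalizing T with
  | nil => simpa using ⟨_, Exec.skip _⟩
  | cons hV _ ih =>
    have := (runs_raiseNormal hV T).seq (ih _)
    rw [List.map_cons, List.sum_cons, ← add_assoc]
    exact this

theorem forall₂_normals {X Y Z : VExp} {x y z : Fin 4 → ℝ}
    (hX : ∀ T, X.Computes N (s.scan j T) x) (hY : ∀ T, Y.Computes N (s.scan j T) y)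
    (hZ : ∀ T, Z.Computes N (s.scan j T) z) :
    List.Forall₂ (fun V v => ∀ T, VExp.Computes N (s.scan j T) V v) (normals basisExp X Y Z)
      (normals stdBasis x y z) := by
  have hE : ∀ i T, VExp.Computes N (s.scan j T) (basisExp i) (stdBasis i) := by
    intro i T l
    unfold basisExp stdBasis
    split_ifs
    · exact_mod_cast RExp.Computes.const (N := N) (s := s.scan j T) 1
    · exact_mod_cast RExp.Computes.const (N := N) (s := s.scan j T) 0
  have hmap : ∀ {F : Fin 4 → VExp} {f : Fin 4 → Fin 4 → ℝ},
      (∀ i T, VExp.Computes N (s.scan j T) (F i) (f i)) →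
      List.Forall₂ (fun V v => ∀ T, VExp.Computes N (s.scan j T) V v)
        ((List.finRange 4).map F) ((List.finRange 4).map f) := by
    intro F f h
    rw [List.forall₂_map_left_iff, List.forall₂_map_right_iff, List.forall₂_same]
    exact fun i _ => h i
  unfold normals
  refine List.rel_append (List.rel_append (.cons (fun T => (hX T).cross (hY T) (hZ T))
    (hmap fun i T => (hX T).cross (hY T) (hE i T)))
    (hmap fun i T => (hX T).cross (hZ T) (hE i T))) ?_
  refine List.rel_flatMap (R := Eq) ?_ ?_
  · exact List.forall₂_same.2 fun _ _ => rfl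
  · rintro i _ rfl
    exact hmap fun l T => (hX T).cross (hE i T) (hE l T)

/-- All bounds are added to a parameter that is already at least `2`. Since it only grows, earlier
escapes persist. -/
theorem runs_raise {X Y Z : VExp} {x y z : Fin 4 → ℝ} (hx : x ≠ 0)
    (hX : ∀ T, X.Computes N (s.scan j T) x) (hY : ∀ T, Y.Computes N (s.scan j T) y)
    (hZ : ∀ T, Z.Computes N (s.scan j T) z) {T : ℝ} (hT : 2 ≤ T) :
    ∃ T' ≥ T, Escapes x y z T' ∧ Runs N (raise X Y Z) (s.scan j T) (s.scan j T') := by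
  have hnonneg : ∀ r ∈ (normals stdBasis x y z).map escapeBound, 0 ≤ r := by
    intro r hr
    obtain ⟨v, -, rfl⟩ := List.mem_map.1 hr
    exact escapeBound_nonneg v
  refine ⟨_, ?_, escapes_of_le hx fun v hv => ?_, runs_raiseNormals (forall₂_normals hX hY hZ) T⟩
  · exact le_add_of_nonneg_right (List.sum_nonneg hnonneg)
  · exact add_le_add hT (List.single_le_sum hnonneg _ (List.mem_map_of_mem hv))

end Raise

end RealRAM

namespace RealRAM

/-! ## The program

The index variables `0`, `1`, `2` hold the number of edges, the current joint, and the edge that is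
scanned; the real variables `0, …, 3` hold the direction of the rod and the real variable `4` the
parameter of the twisted curve. -/

/-- The position of a vertex. -/
def vertex (e : NExp) : VExp := fun i => .get i e

/-- The difference of two vertices. -/
def vertexDiff (e f : NExp) : VExp := fun i => vertex e i - vertex f i

/-- The direction of the rod. -/
def rodDir : VExp := fun i => .var i

/-- The direction of the edge after the rod. -/
def edgeDir : VExp := (vertexDiff (.var 1) (.succ (.var 1))).unit

/-- The vector in general position. -/
def genericDir : VExp :=
  VExp.unit ![.const 1, .var 4, .var 4 * .var 4, .var 4 * .var 4 * .var 4]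

/-- The vector that is orthogonal to the edge after the rod. -/
def normalDir : VExp := edgeDir.perp genericDir

/-- The cosine of the angle between the generic vector and the edge after the rod. -/
def cosAngle : RExp := dot edgeDir genericDir

/-- The sine of half this angle. -/
def sinHalf : RExp := .sqrt ((.const 1 - cosAngle) / .const 2)

/-- The cosine of half this angle. -/
def cosHalf : RExp := .sqrt ((.const 1 + cosAngle) / .const 2)

/-- Make sure that the generic vector avoids the edge `2`. -/
def scanEdge : Prog :=
  .seq (.seq
    (raise rodDir (vertexDiff (.var 2) (.var 1)) (vertexDiff (.succ (.var 2)) (.var 1)))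
    (raise edgeDir (vertexDiff (.var 2) (.var 1)) (vertexDiff (.succ (.var 2)) (.var 1))))
    (.setIdx 2 (.succ (.var 2)))

/-- Prepare the search for the generic vector. -/
def prepareScan : Prog :=
  .seq (.seq (.setReg 4 (.const 2)) (raise rodDir edgeDir edgeDir))
    (.setIdx 2 (.succ (.var 1)))

/-- Search the generic vector. -/
def scanEdges : Prog := .while (.nlt (.var 2) (.var 0)) scanEdge

/-- Write the three moves that straighten the current joint. -/
def writeMoves : Prog :=
  .seq (.seq (writeMove (.var 1) rodDir (rodDir.perp genericDir) (dot rodDir genericDir))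
    (writeMove (.succ (.var 1)) edgeDir normalDir sinHalf))
    (writeMove (.var 1) (fun i => cosHalf * normalDir i - sinHalf * edgeDir i)
      (VExp.comb cosHalf edgeDir sinHalf normalDir) cosAngle)

/-- Set the direction of the rod. -/
def setRodDir (V : VExp) : Prog :=
  .seq (.seq (.setReg 0 (V 0)) (.setReg 1 (V 1))) (.seq (.setReg 2 (V 2)) (.setReg 3 (V 3)))

/-- Write the moves for the current joint and proceed to the next joint. -/
def finishJoint : Prog :=
  .seq (.seq writeMoves (setRodDir (VExp.comb sinHalf edgeDir cosHalf normalDir)))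
    (.setIdx 1 (.succ (.var 1)))

/-- Straighten the current joint. -/
def straightenJoint : Prog := .seq (.seq prepareScan scanEdges) finishJoint

/-- The first edge is the first rod. -/
def firstRod : Prog :=
  .seq (.setIdx 1 (.const 1)) (setRodDir (vertexDiff (.const 0) (.const 1)).unit)

/-- The program that straightens a chain. -/
def straighten : Prog :=
  .seq firstRod (.while (.nlt (.var 1) (.var 0)) straightenJoint)

theorem loopFree_setRodDir (V : VExp) : (setRodDir V).LoopFree := by
  simp [setRodDir, Prog.LoopFree]

theorem loopFree_writeMove (e : NExp) (A B : VExp) (c : RExp) :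
    (writeMove e A B c).LoopFree := by
  simp [writeMove, writeVec, Prog.LoopFree]

theorem loopFree_scanEdge : scanEdge.LoopFree :=
  ⟨⟨loopFree_raise _ _ _, loopFree_raise _ _ _⟩, trivial⟩

theorem loopFree_prepareScan : prepareScan.LoopFree := ⟨⟨trivial, loopFree_raise _ _ _⟩, trivial⟩

theorem loopFree_finishJoint : finishJoint.LoopFree :=
  ⟨⟨⟨⟨loopFree_writeMove _ _ _ _, loopFree_writeMove _ _ _ _⟩, loopFree_writeMove _ _ _ _⟩,
    loopFree_setRodDir _⟩, trivial⟩

theorem loopFree_firstRod : firstRod.LoopFree := ⟨trivial, loopFree_setRodDir _⟩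

/-! ### Correctness and running time of the program -/

section Correctness

variable {n : ℕ} {P : Chain n} {s : State}

theorem computes_vertex (h : s.arr = (input P).arr) {e : NExp} {i : Fin (n + 1)}
    (he : e.eval s = i) : (vertex e).Computes (n + 1) s (P i).ofLp := by
  intro l
  refine ⟨by rw [vertex, RExp.Defined, he]; exact i.2, ?_⟩
  rw [vertex, RExp.eval, he, h]
  have hi := i.2
  exact dif_pos ⟨l.2, hi⟩

theorem computes_vertexDiff (h : s.arr = (input P).arr) {e f : NExp} {i j : Fin (n + 1)}
    (he : e.eval s = i) (hf : f.eval s = j) :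
    (vertexDiff e f).Computes (n + 1) s (P i - P j).ofLp :=
  fun l => (computes_vertex h he l).sub (computes_vertex h hf l)

/-- The state `s` describes the chain `P` whose `k`-th joint is the next to be straightened. -/
structure View (P : Chain n) (k : Fin n) (s : State) : Prop where
  length : s.idx 0 = n
  joint : s.idx 1 = k
  arr : s.arr = (input P).arr

theorem View.scan {k : Fin n} (h : View P k s) (j : ℕ) (T : ℝ) : View P k (s.scan j T) :=
  ⟨by simpa [State.scan] using h.length, by simpa [State.scan] using h.joint, h.arr⟩

/-- The direction of an edge, seen from its end. -/
noncomputable def backDir (P : Chain n) (k : Fin n) : E4 := unitVec (P k.castSucc - P k.succ)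

/-- The generic vector with parameter `T`. -/
noncomputable def generic (T : ℝ) : E4 := unitVec (WithLp.toLp 2 (twistedCurve T))

theorem twistedCurve_ne_zero (T : ℝ) : WithLp.toLp 2 (twistedCurve T) ≠ 0 := fun h => by
  have := congrArg (fun v : E4 => v 0) h
  simp [twistedCurve] at this

theorem norm_generic (T : ℝ) : ‖generic T‖ = 1 := norm_unitVec (twistedCurve_ne_zero T)

theorem View.computes_edgeDir {k : Fin n} (h : View P k s)
    (hne : P k.castSucc ≠ P k.succ) : edgeDir.Computes (n + 1) s (backDir P k).ofLp := by
  refine VExp.Computes.unit (sub_ne_zero.2 hne) (computes_vertexDiff h.arr ?_ ?_)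
  · simp [NExp.eval, h.joint]
  · simp [NExp.eval, h.joint]

theorem computes_genericDir {N : ℕ} {T : ℝ} (hT : s.reg 4 = T) :
    genericDir.Computes N s (generic T).ofLp := by
  refine VExp.Computes.unit (twistedCurve_ne_zero T) ?_
  have h4 : (RExp.var 4).Computes N s T := ⟨trivial, hT⟩
  intro i
  fin_cases i
  · exact ⟨trivial, by simp [RExp.eval, twistedCurve]⟩
  · exact h4
  · have := h4.mul h4
    rw [← sq] at this
    exact this
  · have := (h4.mul h4).mul h4
    rw [← sq, ← pow_succ] at this
    exact this

/-- Spans are invariant under scaling, so normalising the curve point is harmless. Points of an edge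
enter as combinations of its two ends. -/
theorem Escapes.generic_ne {a Y Z : E4} {T : ℝ} (h : Escapes a.ofLp Y.ofLp Z.ofLp T)
    (α β x y : ℝ) : generic T ≠ α • a + β • (x • Y + y • Z) := by
  intro e
  have hne := twistedCurve_ne_zero T
  set W : E4 := WithLp.toLp 2 (twistedCurve T) with hW
  refine h T le_rfl (‖W‖ * α) (‖W‖ * β * x) (‖W‖ * β * y) ?_
  have e' : W = (‖W‖ * α) • a + (‖W‖ * β * x) • Y + (‖W‖ * β * y) • Z := by
    rw [generic] at e
    conv_lhs => rw [← smul_unitVec hne, e]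
    module
  have := congrArg (fun v : E4 => v.ofLp) e'
  simpa [hW] using this

theorem runs_setIdx {N : ℕ} {e : NExp} {j : ℕ} (i : ℕ) (h : e.eval s = j) :
    Runs N (.setIdx i e) s { s with idx := Function.update s.idx i j } := by
  subst h
  exact ⟨_, Exec.setIdx i e s⟩

/-- The generic vector avoids all edges after the `k`-th one that come before the `j`-th one. -/
def Avoids (P : Chain n) (k : Fin n) (a : E4) (j : ℕ) (T : ℝ) : Prop :=
  Escapes a.ofLp (backDir P k).ofLp (backDir P k).ofLp T ∧
    ∀ i : Fin n, k < i → (i : ℕ) < j →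
      Escapes a.ofLp (P i.castSucc - P k.castSucc).ofLp (P i.succ - P k.castSucc).ofLp T ∧
      Escapes (backDir P k).ofLp (P i.castSucc - P k.castSucc).ofLp
        (P i.succ - P k.castSucc).ofLp T

theorem ofLp_ne_zero {a : E4} (ha : ‖a‖ = 1) : a.ofLp ≠ 0 := fun h => by
  have : a = 0 := by ext i; simp [h]
  rw [this, norm_zero] at ha
  exact zero_ne_one ha

variable {k : Fin n} {a : E4}

theorem computes_rodDir {N : ℕ} (h : ∀ i : Fin 4, s.reg i = a i) (j : ℕ) (T : ℝ) :
    rodDir.Computes N (s.scan j T) a.ofLp := fun i =>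
  ⟨trivial, by
    rw [rodDir, RExp.eval, ← h i]
    exact Function.update_of_ne (by have := i.2; omega) _ _⟩

theorem runs_scanEdge (hv : View P k s) (hne : P k.castSucc ≠ P k.succ)
    (hrod : ∀ i : Fin 4, s.reg i = a i) (ha : ‖a‖ = 1) (j : Fin n) {T : ℝ} (hT : 2 ≤ T)
    (hav : Avoids P k a j T) :
    ∃ T' ≥ (2 : ℝ), Avoids P k a (j + 1) T' ∧
      Runs (n + 1) scanEdge (s.scan j T) (s.scan (j + 1) T') := by
  have hY : ∀ T, (vertexDiff (.var 2) (.var 1)).Computes (n + 1) (s.scan j T)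
      (P j.castSucc - P k.castSucc).ofLp := fun T =>
    computes_vertexDiff (hv.scan j T).arr (by simp [NExp.eval, State.scan])
      (by simp [NExp.eval, (hv.scan j T).joint])
  have hZ : ∀ T, (vertexDiff (.succ (.var 2)) (.var 1)).Computes (n + 1) (s.scan j T)
      (P j.succ - P k.castSucc).ofLp := fun T =>
    computes_vertexDiff (hv.scan j T).arr (by simp [NExp.eval, State.scan])
      (by simp [NExp.eval, (hv.scan j T).joint])
  have hu : ‖backDir P k‖ = 1 := norm_unitVec (sub_ne_zero.2 hne)
  obtain ⟨T₁, h₁, e₁, r₁⟩ := runs_raise (ofLp_ne_zero ha) (fun T => computes_rodDir hrod j T)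
    hY hZ hT
  obtain ⟨T₂, h₂, e₂, r₂⟩ := runs_raise (ofLp_ne_zero hu)
    (fun T => (hv.scan j T).computes_edgeDir hne) hY hZ (hT.trans h₁)
  refine ⟨T₂, hT.trans (h₁.trans h₂), ⟨hav.1.mono (h₁.trans h₂), fun i hi hij => ?_⟩, ?_⟩
  · rcases Nat.lt_succ_iff_lt_or_eq.1 hij with hij | hij
    · obtain ⟨g₁, g₂⟩ := hav.2 i hi hij
      exact ⟨g₁.mono (h₁.trans h₂), g₂.mono (h₁.trans h₂)⟩
    · obtain rfl := Fin.ext hij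
      exact ⟨e₁.mono h₂, e₂⟩
  · have := (r₁.seq r₂).seq (runs_setIdx (j := (j : ℕ) + 1) (N := n + 1) 2
      (e := .succ (.var 2)) (by simp [NExp.eval, State.scan]))
    simpa [scanEdge, State.scan] using this

/-- Only the plane of the rod and the next edge is avoided here, with the edge direction repeated as
third vector; no edge index lies strictly between `k` and `k + 1`. -/
theorem runs_prepareScan (hv : View P k s) (hne : P k.castSucc ≠ P k.succ)
    (hrod : ∀ i : Fin 4, s.reg i = a i) (ha : ‖a‖ = 1) :
    ∃ T ≥ (2 : ℝ), Avoids P k a (k + 1) T ∧ Runs (n + 1) prepareScan s (s.scan (k + 1) T) := by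
  have h₀ : Runs (n + 1) (.setReg 4 (.const 2)) s (s.scan (s.idx 2) 2) := by
    have h2 : (RExp.const 2).Computes (n + 1) s 2 := ⟨trivial, by simp [RExp.eval]⟩
    simpa [State.scan] using runs_setReg 4 h2
  have hU := fun T => (hv.scan (s.idx 2) T).computes_edgeDir hne
  obtain ⟨T, hT, e, r⟩ := runs_raise (ofLp_ne_zero ha)
    (fun T => computes_rodDir hrod (s.idx 2) T) hU hU le_rfl
  refine ⟨T, hT, ⟨e, fun i hi hij => ?_⟩, ?_⟩
  · have : (k : ℕ) < i := hi
    omega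
  · have := (h₀.seq r).seq (runs_setIdx (j := (k : ℕ) + 1) (N := n + 1) 2
      (e := .succ (.var 1)) (by simp [NExp.eval, (hv.scan _ _).joint]))
    simpa [prepareScan, State.scan] using this

theorem exec_scanEdges (hv : View P k s) (hne : P k.castSucc ≠ P k.succ)
    (hrod : ∀ i : Fin 4, s.reg i = a i) (ha : ‖a‖ = 1) {T : ℝ} (hT : 2 ≤ T)
    (hav : Avoids P k a (k + 1) T) :
    ∃ T' t, Avoids P k a n T' ∧ t ≤ n * (3 + scanEdge.bound + 1) ∧
      Exec (n + 1) scanEdges (s.scan (k + 1) T) t (s.scan n T') := by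
  have hholds : ∀ j T, (BExp.nlt (.var 2) (.var 0)).Holds (s.scan j T) ↔ j < n := fun j T => by
    simp [BExp.Holds, NExp.eval, (hv.scan j T).length]
    simp [State.scan]
  obtain ⟨s', t, h₁, h₂, j, T', hj, hs, -, hav'⟩ := exec_while (N := n + 1)
    (b := .nlt (.var 2) (.var 0)) (p := scanEdge) (K := scanEdge.bound)
    (fun m s' => ∃ j T, j + m = n ∧ s' = s.scan j T ∧ 2 ≤ T ∧ Avoids P k a j T)
    (by
      rintro m s' ⟨j, T, hj, rfl, hT, hav⟩
      obtain ⟨T', hT', hav', r⟩ :=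
        runs_scanEdge hv hne hrod ha ⟨j, by omega⟩ hT hav
      obtain ⟨t, ht, r⟩ := r.exec loopFree_scanEdge
      exact ⟨trivial, (hholds j T).2 (by omega), _, t, r, ht, j + 1, T', by omega, rfl, hT',
        hav'⟩)
    (by
      rintro s' ⟨j, T, hj, rfl, -, -⟩
      exact ⟨trivial, by rw [hholds]; omega⟩)
    (n - (k + 1)) (s.scan (k + 1) T) ⟨k + 1, T, by have := k.2; omega, rfl, hT, hav⟩
  rw [add_zero] at hj
  subst hj hs
  refine ⟨T', t, hav', h₂.trans ?_, h₁⟩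
  have hb : (BExp.nlt (.var 2) (.var 0)).cost = 3 := rfl
  rw [hb]
  exact Nat.mul_le_mul_right _ (by have := k.2; omega)

/-- The state with the direction of the rod set to `a`. -/
noncomputable def State.setRod (s : State) (a : E4) : State :=
  { s with reg := fun i => if h : i < 4 then a ⟨i, h⟩ else s.reg i }

/-- The registers `0` to `3` are overwritten one by one, so the value of `V` must not depend on
them. -/
theorem runs_setRodDir {N : ℕ} {V : VExp} {v : E4}
    (h : ∀ g : ℕ → ℝ, (∀ i, 4 ≤ i → g i = s.reg i) → V.Computes N { s with reg := g } v.ofLp) :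
    Runs N (setRodDir V) s (s.setRod v) := by
  have h₀ := runs_setReg 0 (h s.reg (fun _ _ => rfl) 0)
  have h₁ := runs_setReg 1 (h (Function.update s.reg 0 (v 0)) (fun i hi => by
    rw [Function.update_of_ne (by omega)]) 1)
  have h₂ := runs_setReg 2 (h (Function.update (Function.update s.reg 0 (v 0)) 1 (v 1))
    (fun i hi => by rw [Function.update_of_ne (by omega), Function.update_of_ne (by omega)]) 2)
  have h₃ := runs_setReg 3 (h (Function.update (Function.update (Function.update s.reg 0 (v 0))
    1 (v 1)) 2 (v 2)) (fun i hi => by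
      rw [Function.update_of_ne (by omega), Function.update_of_ne (by omega),
        Function.update_of_ne (by omega)]) 3)
  have hs : s.setRod v = { s with reg := Function.update (Function.update (Function.update
      (Function.update s.reg 0 (v 0)) 1 (v 1)) 2 (v 2)) 3 (v 3) } := by
    unfold State.setRod
    congr 1
    funext i
    match i with
    | 0 => simp
    | 1 => simp
    | 2 => simp
    | 3 => simp
    | i + 4 => simp
  rw [hs]
  exact (h₀.seq h₁).seq (h₂.seq h₃)

theorem State.setRod_reg (s : State) (a : E4) (i : Fin 4) : (s.setRod a).reg i = a i := by
  simp [State.setRod]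

theorem runs_finishJoint (hv : View P k s) (hne : P k.castSucc ≠ P k.succ)
    (hrod : ∀ i : Fin 4, s.reg i = a i) {T : ℝ} {u w b : E4} {c c' s' : ℝ}
    (hu : u = backDir P k) (hw : w = generic T) (hb : b = perp u w) (hc : c = inner ℝ u w)
    (hc' : c' = √((1 - c) / 2)) (hs' : s' = √((1 + c) / 2)) (hwa : ∀ α : ℝ, w ≠ α • a)
    (hwu : ∀ α : ℝ, w ≠ α • u) :
    ∃ s₁ : State, Runs (n + 1) finishJoint (s.scan n T) s₁ ∧ s₁.idx 0 = n ∧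
      s₁.idx 1 = k + 1 ∧ s₁.arr = (input P).arr ∧
      (∀ i : Fin 4, s₁.reg i = (c' • u + s' • b) i) ∧
      s₁.out = s.out ++ (Move.words k a (perp a w) (inner ℝ a w) ++
        Move.words (k + 1) u b c' ++ Move.words k (s' • b - c' • u) (s' • u + c' • b) c) := by
  have hun : ‖u‖ = 1 := by rw [hu]; exact norm_unitVec (sub_ne_zero.2 hne)
  have hwn : ‖w‖ = 1 := by rw [hw]; exact norm_generic T
  -- Keeps both radicands nonnegative, so that the square roots are defined operations.
  have habs : |c| ≤ 1 := by
    have := abs_real_inner_le_norm u w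
    rwa [hun, hwn, one_mul, ← hc] at this
  obtain ⟨hc1, hc2⟩ := abs_le.1 habs
  -- the values of the expressions
  have vals : ∀ q : State, View P k q → q.reg 4 = T →
      edgeDir.Computes (n + 1) q u.ofLp ∧ genericDir.Computes (n + 1) q w.ofLp ∧
      normalDir.Computes (n + 1) q b.ofLp ∧ cosAngle.Computes (n + 1) q c ∧
      sinHalf.Computes (n + 1) q c' ∧ cosHalf.Computes (n + 1) q s' := by
    intro q hq hqT
    have e₁ : edgeDir.Computes (n + 1) q u.ofLp := by rw [hu]; exact hq.computes_edgeDir hne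
    have e₂ : genericDir.Computes (n + 1) q w.ofLp := by rw [hw]; exact computes_genericDir hqT
    have e₃ : cosAngle.Computes (n + 1) q c := by rw [hc]; exact e₁.inner e₂
    have one : (RExp.const 1).Computes (n + 1) q 1 := ⟨trivial, by simp [RExp.eval]⟩
    have two : (RExp.const 2).Computes (n + 1) q 2 := ⟨trivial, by simp [RExp.eval]⟩
    refine ⟨e₁, e₂, by rw [hb]; exact e₁.perp e₂ hwu, e₃, ?_, ?_⟩
    · rw [hc']
      exact ((one.sub e₃).div two two_ne_zero).sqrt (by linarith)
    · rw [hs']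
      exact ((one.add e₃).div two two_ne_zero).sqrt (by linarith)
  have hT : ∀ q : State, q.reg = (s.scan n T).reg → q.reg 4 = T := fun q hq => by
    simp [hq, State.scan]
  have hview : ∀ o, View P k { s.scan n T with out := o } := fun o =>
    ⟨(hv.scan n T).length, (hv.scan n T).joint, hv.arr⟩
  have hR : ∀ o, rodDir.Computes (n + 1) { s.scan n T with out := o } a.ofLp := fun o i =>
    (computes_rodDir hrod n T i).of_out o
  have move₁ : ∀ o, Runs (n + 1) (writeMove (.var 1) rodDir (rodDir.perp genericDir)
      (dot rodDir genericDir)) { s.scan n T with out := o }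
      { s.scan n T with out := o ++ Move.words k a (perp a w) (inner ℝ a w) } := fun o => by
    obtain ⟨e₁, e₂, -⟩ := vals _ (hview o) (hT _ rfl)
    exact runs_writeMove (hview o).joint (hR o) ((hR o).perp e₂ hwa) ((hR o).inner e₂)
  have move₂ : ∀ o, Runs (n + 1) (writeMove (.succ (.var 1)) edgeDir normalDir sinHalf)
      { s.scan n T with out := o }
      { s.scan n T with out := o ++ Move.words (k + 1) u b c' } := fun o => by
    obtain ⟨e₁, -, e₃, -, e₅, -⟩ := vals _ (hview o) (hT _ rfl)
    exact runs_writeMove (congrArg (· + 1) (hview o).joint) e₁ e₃ e₅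
  have move₃ : ∀ o, Runs (n + 1)
      (writeMove (.var 1) (fun i => cosHalf * normalDir i - sinHalf * edgeDir i)
        (VExp.comb cosHalf edgeDir sinHalf normalDir) cosAngle)
      { s.scan n T with out := o }
      { s.scan n T with
        out := o ++ Move.words k (s' • b - c' • u) (s' • u + c' • b) c } := fun o => by
    obtain ⟨e₁, -, e₃, e₄, e₅, e₆⟩ := vals _ (hview o) (hT _ rfl)
    exact runs_writeMove (hview o).joint (fun i => (e₆.mul (e₃ i)).sub (e₅.mul (e₁ i)))
      (VExp.Computes.comb e₆ e₁ e₅ e₃) e₄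
  have hset : ∀ o, Runs (n + 1) (setRodDir (VExp.comb sinHalf edgeDir cosHalf normalDir))
      { s.scan n T with out := o }
      (State.setRod { s.scan n T with out := o } (c' • u + s' • b)) := fun o => by
    refine runs_setRodDir fun g hg => ?_
    obtain ⟨e₁, -, e₃, -, e₅, e₆⟩ := vals { s.scan n T with out := o, reg := g }
      ⟨(hview o).length, (hview o).joint, (hview o).arr⟩
      ((hg 4 le_rfl).trans (hT _ rfl))
    exact VExp.Computes.comb e₅ e₁ e₆ e₃
  have run := ((((move₁ s.out).seq (move₂ _)).seq (move₃ _)).seq (hset _)).seq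
    (runs_setIdx (j := (k : ℕ) + 1) (e := .succ (.var 1)) 1
      (congrArg (· + 1) (hv.scan n T).joint))
  refine ⟨_, run, ?_, ?_, hv.arr, fun i => State.setRod_reg _ _ i, ?_⟩
  · simpa [State.setRod] using (hv.scan n T).length
  · simp [State.setRod]
  · simp [State.setRod]

/-- The joints before the one in the index variable `1`, which has `m` joints after it, are
straight after the moves that have been written. -/
def JointInv (P : Chain n) (m : ℕ) (s : State) : Prop :=
  ∃ k : Fin (n + 1), (k : ℕ) + m = n ∧ s.idx 0 = n ∧ s.idx 1 = k ∧ s.arr = (input P).arr ∧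
    ∃ a : E4, ‖a‖ = 1 ∧ (∀ i : Fin 4, s.reg i = a i) ∧ ∃ ms : List (Move n),
      s.out = ms.flatMap Move.encode ∧ ms.length ≤ 3 * k ∧ StaysSimple ms P ∧
      (perform ms P).Rod k a ∧ ∀ i, k ≤ i → perform ms P i = P i

/-- A bound on the number of steps for one joint, apart from a factor `n`. -/
def jointBound : ℕ := prepareScan.bound + (3 + scanEdge.bound + 1) + finishJoint.bound

/-- The program reads the input `P`, but the moves act on `Q = perform ms P`. Both agree from the
joint on, and the rod enters only through `a`. -/
theorem exec_straightenJoint {m : ℕ} (h : JointInv P (m + 1) s) :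
    (BExp.nlt (.var 1) (.var 0)).Holds s ∧ ∃ s' t, Exec (n + 1) straightenJoint s t s' ∧
      t ≤ jointBound * n ∧ JointInv P m s' := by
  obtain ⟨k₀, hk, h0, h1, harr, a, ha, hrod, ms, hout, hlen, hms, hRod, hge⟩ := h
  obtain ⟨k, rfl⟩ : ∃ k : Fin n, k₀ = k.castSucc := ⟨⟨k₀, by omega⟩, rfl⟩
  rw [Fin.val_castSucc] at hk h1 hlen
  have hv : View P k s := ⟨h0, h1, harr⟩
  set Q := perform ms P with hQdef
  have hQ : Q.IsSimple := hms.perform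
  have hQk : Q k.castSucc = P k.castSucc := hge _ le_rfl
  have hQge : ∀ i, k.succ ≤ i → Q i = P i := fun i hi => hge i (k.castSucc_lt_succ.le.trans hi)
  have hQk' : Q k.succ = P k.succ := hQge _ le_rfl
  have hne : P k.castSucc ≠ P k.succ := by
    rw [← hQk, ← hQk']; exact hQ.nondegenerate k
  obtain ⟨T₀, hT₀, hav₀, r₀⟩ := runs_prepareScan hv hne hrod ha
  obtain ⟨t₀, ht₀, r₀⟩ := r₀.exec loopFree_prepareScan
  obtain ⟨T, t₁, hav, ht₁, r₁⟩ := exec_scanEdges hv hne hrod ha hT₀ hav₀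
  have hedge : ∀ j : Fin n, k ≤ j → ∀ q ∈ Q.edge j, ∃ x y : ℝ,
      q - Q k.castSucc = x • (P j.castSucc - P k.castSucc) + y • (P j.succ - P k.castSucc) := by
    rintro j hj q ⟨x, y, hx, hy, hxy, rfl⟩
    refine ⟨x, y, ?_⟩
    rw [hge j.castSucc hj, hge j.succ (le_trans hj j.castSucc_lt_succ.le), hQk]
    obtain rfl : y = 1 - x := by linarith
    module
  have hgen₀ : ∀ j : Fin n, k ≤ j → ∀ q ∈ Q.edge j, ∀ α β : ℝ,
      generic T ≠ α • a + β • (q - Q k.castSucc) := by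
    intro j hj q hq α β
    obtain ⟨x, y, hxy⟩ := hedge j hj q hq
    rw [hxy]
    rcases hj.lt_or_eq with hj | rfl
    · exact Escapes.generic_ne (hav.2 j hj j.2).1 α β x y
    -- On the edge `k` itself, `q - v_k` is a multiple of `u`, so the first clause of `Avoids`
    -- applies.
    · have e : P k.succ - P k.castSucc = (-‖P k.castSucc - P k.succ‖) • backDir P k := by
        rw [backDir, neg_smul, smul_unitVec (sub_ne_zero.2 hne), neg_sub]
      have := Escapes.generic_ne hav.1 α β (y * -‖P k.castSucc - P k.succ‖) 0
      rw [zero_smul, add_zero] at this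
      rwa [sub_self, smul_zero, zero_add, e, smul_smul y]
  have hgen : ∀ j : Fin n, k < j → ∀ q ∈ Q.edge j, ∀ α β : ℝ,
      generic T ≠ α • backDir P k + β • (q - Q k.castSucc) := by
    intro j hj q hq α β
    obtain ⟨x, y, hxy⟩ := hedge j hj.le q hq
    rw [hxy]
    exact Escapes.generic_ne (hav.2 j hj j.2).2 α β x y
  have hwa : ∀ α : ℝ, generic T ≠ α • a := fun α => by
    simpa using Escapes.generic_ne hav.1 α 0 0 0
  have hwu : ∀ α : ℝ, generic T ≠ α • backDir P k := fun α => by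
    simpa using Escapes.generic_ne hav.1 0 α 1 0
  obtain ⟨s₁, r₂, g0, g1, garr, grod, gout⟩ :=
    runs_finishJoint hv hne hrod rfl rfl rfl rfl rfl rfl hwa hwu
  obtain ⟨t₂, ht₂, r₂⟩ := r₂.exec loopFree_finishJoint
  obtain ⟨ms', hlen', hms', henc, hRod', hnorm, hge'⟩ :=
    exists_moves_of_rod hQ k ha (norm_generic T) hRod (u := backDir P k)
      (by rw [backDir, hQk, hQk']) rfl rfl rfl rfl hgen₀ hgen
  refine ⟨?_, s₁, _, (r₀.seq r₁).seq r₂, ?_, k.succ, ?_, g0, ?_, garr, _, hnorm, grod,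
    ms ++ ms', ?_, ?_, hms.append hms', ?_, ?_⟩
  · simp only [BExp.Holds, NExp.eval, h0, h1]
    exact k.2
  · have hn : 1 ≤ n := by have := k.2; omega
    unfold jointBound
    have e₀ := Nat.le_mul_of_pos_right prepareScan.bound hn
    have e₂ := Nat.le_mul_of_pos_right finishJoint.bound hn
    have e₁ : n * (3 + scanEdge.bound + 1) = (3 + scanEdge.bound + 1) * n := mul_comm _ _
    rw [add_mul, add_mul]
    omega
  · rw [Fin.val_succ]; omega
  · rw [g1, Fin.val_succ]
  · rw [gout, hout, List.flatMap_append, henc]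
  · rw [List.length_append, hlen', Fin.val_succ]; omega
  · rw [perform_append]; exact hRod'
  · intro i hi
    rw [perform_append, hge' i hi, hQge i hi]

/-- One edge is already a rod, so the first joint is `1` and no move has been made. -/
theorem jointInv_firstRod (hn : 1 ≤ n) (hP : P.IsSimple) :
    ∃ s, Runs (n + 1) firstRod (input P) s ∧ JointInv P (n - 1) s := by
  let k : Fin n := ⟨0, hn⟩
  have hne : P k.castSucc ≠ P k.succ := hP.nondegenerate k
  have hidx := runs_setIdx (s := input P) (N := n + 1) (e := .const 1) 1 rfl
  have hset : Runs (n + 1) (setRodDir (vertexDiff (.const 0) (.const 1)).unit)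
      { input P with idx := Function.update (input P).idx 1 1 }
      (State.setRod { input P with idx := Function.update (input P).idx 1 1 } (backDir P k)) := by
    refine runs_setRodDir fun g _ => VExp.Computes.unit (sub_ne_zero.2 hne) ?_
    exact computes_vertexDiff (i := k.castSucc) (j := k.succ) (by rfl) (by rfl) (by rfl)
  refine ⟨_, hidx.seq hset, k.succ, ?_, ?_, ?_, rfl, backDir P k,
    norm_unitVec (sub_ne_zero.2 hne), fun i => State.setRod_reg _ _ i, [], rfl, by simp, hP, ?_,
    fun _ _ => rfl⟩
  · simp [k]; omega
  · simp [State.setRod, input]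
  · simp [State.setRod, k]
  · intro i j hij hj
    have hi : i = k.castSucc := Fin.ext (by
      have h1 : (i : ℕ) < j := hij
      have h2 : (j : ℕ) ≤ 0 + 1 := hj
      change (i : ℕ) = 0
      omega)
    have hj' : j = k.succ := Fin.ext (by
      have h1 : (i : ℕ) < j := hij
      have h2 : (j : ℕ) ≤ 0 + 1 := hj
      change (j : ℕ) = 0 + 1
      omega)
    refine ⟨‖P k.castSucc - P k.succ‖, norm_pos_iff.2 (sub_ne_zero.2 hne), ?_⟩
    rw [hi, hj', backDir, smul_unitVec (sub_ne_zero.2 hne)]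
    exact (add_sub_cancel _ _).symm

theorem exec_straighten (hn : 1 ≤ n) (hP : P.IsSimple) :
    ∃ s t, Exec (n + 1) straighten (input P) t s ∧
      t ≤ (firstRod.bound + (3 + jointBound + 1)) * n ^ 2 ∧ JointInv P 0 s := by
  obtain ⟨s₀, r₀, h₀⟩ := jointInv_firstRod hn hP
  obtain ⟨t₀, ht₀, r₀⟩ := r₀.exec loopFree_firstRod
  obtain ⟨s₁, t₁, r₁, ht₁, h₁⟩ := exec_while (N := n + 1) (b := .nlt (.var 1) (.var 0))
    (p := straightenJoint) (K := jointBound * n) (JointInv P)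
    (fun m s h => ⟨trivial, exec_straightenJoint h⟩)
    (fun s ⟨k, hk, h0, h1, _⟩ => ⟨trivial, by simp only [BExp.Holds, NExp.eval, h0, h1]; omega⟩)
    (n - 1) s₀ h₀
  refine ⟨s₁, _, r₀.seq r₁, ?_, h₁⟩
  have hb : (BExp.nlt (.var 1) (.var 0)).cost = 3 := rfl
  rw [hb, Nat.sub_add_cancel hn] at ht₁
  calc t₀ + t₁ ≤ firstRod.bound * 1 + n * (3 + jointBound * n + 1) := by omega
    _ ≤ firstRod.bound * n ^ 2 + n * (3 * n + jointBound * n + 1 * n) := by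
      gcongr
      · exact Nat.one_le_pow _ _ hn
      · omega
      · omega
    _ = _ := by ring

end Correctness

end RealRAM

theorem theorem1 :
    ∃ (p : RealRAM.Prog) (C : ℕ), ∀ (n : ℕ) (P : Chain n), 1 ≤ n → P.IsSimple →
      ∃ (N time : ℕ) (final : RealRAM.State) (moves : List (Move n)) (γ : ℝ → Chain n),
        RealRAM.Exec N p (RealRAM.input P) time final ∧
        final.out = moves.flatMap Move.encode ∧
        time ≤ C * n ^ 2 ∧
        p.space N ≤ C * n ∧
        moves.length ≤ C * n ∧
        Performs moves γ ∧
        P.IsStraightening (moves.length : ℝ) γ := by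
  -- The summands of the constant pay for time, for space (`n + 3 ≤ 4 n`), and for three moves per
  -- joint.
  refine ⟨RealRAM.straighten, (RealRAM.firstRod.bound + (3 + RealRAM.jointBound + 1)) +
    4 * RealRAM.straighten.width + 3, fun n P hn hP => ?_⟩
  obtain ⟨s, t, hexec, ht, k, hk, -, -, -, a, ha, -, ms, hout, hlen, hms, hrod, -⟩ :=
    RealRAM.exec_straighten hn hP
  obtain rfl : k = Fin.last n := Fin.ext hk
  refine ⟨n + 1, t, s, ms, motion ms P, hexec, hout, ht.trans ?_, ?_, ?_, performs_motion ms P,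
    hms.isStraightening (hrod.isStraight ?_)⟩
  · exact Nat.mul_le_mul_right _ (by omega)
  · calc RealRAM.straighten.width * (n + 1 + 2) ≤ RealRAM.straighten.width * (4 * n) :=
          Nat.mul_le_mul_left _ (by omega)
      _ = 4 * RealRAM.straighten.width * n := by ring
      _ ≤ _ := Nat.mul_le_mul_right _ (by omega)
  · rw [Fin.val_last] at hlen
    exact hlen.trans (Nat.mul_le_mul_right _ (by omega))
  · rintro rfl
    simp at ha
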